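/- **Setting.** Let $x_{t+1}=Ax_t+Bu_t$, let the columns of $(G_x,G_u)$ be a basis of the null space of $[A-I\ \ B]$, and write $x_v=G_xv$, $u_v=G_uv$. Let $\mathcal V$ be a compact convex set of references. For $\Sigma\in\mathbb R$ let $\mathcal X^\Sigma=\{x:\ b_x+\Sigma\mathbf 1\le Cx\le b_x'-\Sigma\mathbf 1\}$, $\mathcal U^\Sigma=\{u:\ b_u+\Sigma\mathbf 1\le Du\le b_u'-\Sigma\mathbf 1\}$; $\mathcal X^0\times\mathcal U^0$ is compact with the origin in its interior, and for some $\underline\Sigma>0$ we have $(x_v,u_v)\in\operatorname{int}(\mathcal X^{\underline\Sigma}\times\mathcal U^{\underline\Sigma})$ for all $v\in\mathcal V$. For a horizon $N\ge1$ and $\Sigma\ge 0$ let $\mathcal P^\Sigma(x,v)$ be the problem of minimizing $$\|x_N-x_v\|_P^2+\sum_{k=0}^{N-1}\big(\|x_k-x_v\|_Q^2+\|u_k-u_v\|_R^2\big)$$ subject to $x_0=x$, $x_{k+1}=Ax_k+Bu_k$, $u_k\in\mathcal U^\Sigma$ and $x_{k+1}\in\mathcal X^\Sigma$ for $0\le k<N$.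 Here $P,Q,R\succ0$ and $P=Q+A^TPA-A^TPBK$ with $K=(R+B^TPB)^{-1}B^TPA$. Let $\Psi(\Sigma)$ be the set of $x$ for which $\mathcal P^\Sigma(x,v)$ is feasible, $\psi^\Sigma(x,v)$ the square root of its optimal value, and $u^{*\Sigma}(x,v)$ the first input of its minimizer. **Constants.** Let $\beta>1$ and $\varphi$ be Lipschitz constants: $|\psi^\Sigma(x,v)-\psi^\Sigma(x',v')|\le\beta\|(x,v)-(x',v')\|$ for $x,x'\in\Psi(\Sigma)$, $v,v'\in\mathcal V$, and $\|u^{*\Sigma}(x,v)-u^{*\Sigma'}(x,v)\|\le\varphi|\Sigma-\Sigma'|$ whenever both minimizers exist. Let $0<\pi_1,\pi_2<1$, let $\bar\lambda$ denote the largest singular value, $d=N\lambda_{\min}(Q)/\lambda_{\max}(P)+1$, and $$\alpha_1=1-\sqrt{1-\lambda_{\min}(Q)/\beta^2},\qquad \zeta_1=\max\{\bar\lambda(B),\sqrt{\bar\lambda(B)}\}\,\beta(\varphi+1),$$ $$\alpha_2=1-\pi_1-\pi_2\bar\lambda(B)(\varphi+1),\qquad \zeta_2=\pi_2\,\frac{\bar\lambda(A-I)+\bar\lambda(B)}{\sqrt{\min\{\lambda_{\min}(Q),\lambda_{\min}(P),\lambda_{\min}(R)\}}}.$$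 Assume $\alpha_1<1$, $0<\alpha_2<1$, $\zeta_2/\alpha_2<\alpha_1/\zeta_1$ and $\alpha_1\sqrt d<1$. **Regions of attraction.** Let $\Gamma^{\Sigma}(v)=\{x\in\Psi(\Sigma):\psi^\Sigma(x,v)\le\sqrt{dp}\}$ and $\check\Gamma(v)=\{x\in\Psi(0):\psi^0(x,v)\le\check\psi\}$. Call $(\Sigma,p,\check\psi)$ *admissible* at $v$ if $\Sigma,p>0$; $\|x-x_v\|_P^2\le p$ implies $x\in\mathcal X^\Sigma$ and $u_v-K(x-x_v)\in\mathcal U^\Sigma$; $\check\psi\le\sqrt{dp}$; and $\check\Gamma(v)\subseteq\Gamma^\Sigma(v)$. **Closed loop (Algorithm 1 and the tightening rule).** The desired reference $v\in\mathcal V$ is constant. At each time $t$ an iterative optimizer, warm started at its final state of time $t-1$, is run on $\mathcal P^{\Sigma_t}(x_t,\hat v_t)$ until its squared primal residual and a computable quantity $\mathcal D^r$ are at most $\Sigma_t^2$; $\hat u_t$ is the first input it returns and $x_{t+1}=Ax_t+B\hat u_t$. On feasible problems with $\Sigma_t>0$ the optimizer is globally convergent, with residual and $\mathcal D^r$ tending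 to $0$; at termination its input sequence satisfies the constraints with $\Sigma=0$, and $\|\hat u_t-u^{*\Sigma_t}(x_t,\hat v_t)\|^2\le\mathcal D^r$. The references are $\hat v_{t+1}=\hat v_t+\kappa_{t+1}(v-\hat v_t)$ with $0\le\kappa_{t+1}\le1$. If $\kappa_{t+1}=0$, then $\Sigma_{t+1}=\pi_1\Sigma_t+\pi_2\|(x_{t+1},\hat v_{t+1})-(x_t,\hat v_t)\|$ and the triple $(\check\Sigma,p,\check\psi)$ in use is kept; if $\kappa_{t+1}>0$, then $\Sigma_{t+1}=\check\Sigma$ for a new triple $(\check\Sigma,p,\check\psi)$ that is admissible at $\hat v_{t+1}$ and satisfies the invariance conditions $$\beta\|\hat v_{t+1}-\hat v_t\|+\psi^0(x_t,\hat v_t)+\zeta_1\Sigma_t\le\check\psi\le\sqrt{dp},\qquad \frac{\zeta_1}{\alpha_1}\Sigma_{t+1}\le\check\psi\le\frac{\alpha_2}{\zeta_2}\Sigma_{t+1}.\qquad(\ast)$$ At time $0$: $\hat v_0\in\mathcal V$, $x_0\in\check\Gamma(\hat v_0)$ and $0<\Sigma_0\le\check\Sigma$ for an initial triple $(\check\Sigma,p,\check\psi)$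 that is admissible at $\hat v_0$ and satisfies the second part of $(\ast)$ with $\check\Sigma$ in place of $\Sigma_{t+1}$. **Theorem 1.** There is $\epsilon_0>0$, depending only on the problem data and constants above, such that for every $0<\epsilon\le\epsilon_0$ and every such optimizer the following hold. (a) Let $v\in\mathcal V$. If the optimizer, run from some initial optimizer state, terminates on $\mathcal P^{\Sigma}(x,v)$ with an input sequence whose cost for the initial state $x$ and reference $v$ is at most $(\beta\epsilon)^2$, then $x$ and the next state $Ax+B\hat u$ lie in $\Psi(\underline\Sigma)$. (b) Consider any closed-loop trajectory up to a time $i'$ with $\|\hat v_{i'}-v\|>\epsilon$. Then there is $i>i'$ such that the trajectory can be continued up to time $i-1$ with $\kappa_t=0$ for all $i'<t\le i-1$, and for every such continuation there are $\kappa_i\in(0,1]$, $\hat v_i=\hat v_{i-1}+\kappa_i(v-\hat v_{i-1})\in\mathcal V$ with $\|\hat v_i-\hat v_{i-1}\|=\epsilon$, and a triple $(\Sigma_i,p,\check\psi)$, admissible at $\hat v_i$, with $\Sigma_i<\underline\Sigma$, such that $x_{i-1}\in\Psi(0)$, $(\ast)$ holds with $t+1=i$, and $x_i\in\check\Gamma(\hat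 v_i)$, that is, the state lies in the region of attraction estimate of the new modified reference. -/

import Mathlib

open Filter Topology

noncomputable section

namespace CompGov

/-- Euclidean space of dimension `n`. -/
abbrev Vec (n : ℕ) := EuclideanSpace ℝ (Fin n)

/-- Matrix-vector product on Euclidean spaces. -/
def mv {m n : ℕ} (M : Matrix (Fin m) (Fin n) ℝ) (x : Vec n) : Vec m :=
  Matrix.toEuclideanLin M x

/-- The weighted square `xᵀ E x`. -/
def wsq {n : ℕ} (E : Matrix (Fin n) (Fin n) ℝ) (x : Vec n) : ℝ :=
  inner ℝ x (mv E x)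

/-- The largest singular value of a matrix, as the operator norm for the Euclidean norms. -/
def maxSing {m n : ℕ} (M : Matrix (Fin m) (Fin n) ℝ) : ℝ :=
  ‖(Matrix.toEuclideanLin M).toContinuousLinearMap‖

/-- The smallest eigenvalue of a symmetric matrix. -/
def lamMin {n : ℕ} (E : Matrix (Fin n) (Fin n) ℝ) : ℝ := sInf (spectrum ℝ E)

/-- The largest eigenvalue of a symmetric matrix. -/
def lamMax {n : ℕ} (E : Matrix (Fin n) (Fin n) ℝ) : ℝ := sSup (spectrum ℝ E)

/-- The Euclidean distance of two parameters `θ = (x, v)`. -/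
def thetaDist {nx nv : ℕ} (x : Vec nx) (v : Vec nv) (x' : Vec nx) (v' : Vec nv) : ℝ :=
  √(‖x - x'‖ ^ 2 + ‖v - v'‖ ^ 2)

/-- The data of the reference-tracking linear-quadratic MPC problem:
the plant `x⁺ = A x + B u`, the parametrization `(Gx v, Gu v)` of its equilibria, the horizon `N`,
the weights, the affine bounds on `C x` and `D u`, and the set of references. -/
structure Problem (nx nu nv mx mu : ℕ) where
  A : Matrix (Fin nx) (Fin nx) ℝ
  B : Matrix (Fin nx) (Fin nu) ℝ
  Gx : Matrix (Fin nx) (Fin nv) ℝ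
  Gu : Matrix (Fin nu) (Fin nv) ℝ
  N : ℕ
  N_pos : 0 < N
  Q : Matrix (Fin nx) (Fin nx) ℝ
  P : Matrix (Fin nx) (Fin nx) ℝ
  R : Matrix (Fin nu) (Fin nu) ℝ
  C : Matrix (Fin mx) (Fin nx) ℝ
  D : Matrix (Fin mu) (Fin nu) ℝ
  xLow : Fin mx → ℝ
  xHigh : Fin mx → ℝ
  uLow : Fin mu → ℝ
  uHigh : Fin mu → ℝ
  refs : Set (Vec nv)

namespace Problem

variable {nx nu nv mx mu : ℕ} (S : Problem nx nu nv mx mu)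

/-- The equilibrium state of a reference. -/
def xEq (v : Vec nv) : Vec nx := mv S.Gx v

/-- The equilibrium input of a reference. -/
def uEq (v : Vec nv) : Vec nu := mv S.Gu v

/-- The state constraint set tightened by `s`. -/
def stateSet (s : ℝ) : Set (Vec nx) :=
  {x | ∀ j, S.xLow j + s ≤ mv S.C x j ∧ mv S.C x j ≤ S.xHigh j - s}

/-- The input constraint set tightened by `s`. -/
def inputSet (s : ℝ) : Set (Vec nu) :=
  {u | ∀ j, S.uLow j + s ≤ mv S.D u j ∧ mv S.D u j ≤ S.uHigh j - s}

/-- An input sequence over the horizon. -/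
abbrev Inputs := Fin S.N → Vec nu

/-- The first input of a sequence. -/
def firstInput (η : S.Inputs) : Vec nu := η ⟨0, S.N_pos⟩

/-- The predicted states from `x` under `η`; only the indices `k ≤ N` are used. -/
def pred (x : Vec nx) (η : S.Inputs) : ℕ → Vec nx
  | 0 => x
  | k + 1 => mv S.A (pred x η k) + if h : k < S.N then mv S.B (η ⟨k, h⟩) else 0

/-- `η` satisfies the constraints of the OCP with tightening `s` and initial state `x`. -/
def Feasible (s : ℝ) (x : Vec nx) (η : S.Inputs) : Prop :=
  (∀ k : Fin S.N, η k ∈ S.inputSet s) ∧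
    ∀ k : Fin S.N, S.pred x η (k.val + 1) ∈ S.stateSet s

/-- The initial states for which the OCP with tightening `s` is feasible. -/
def feasSet (s : ℝ) : Set (Vec nx) := {x | ∃ η, S.Feasible s x η}

/-- The cost of the OCP. -/
def cost (x : Vec nx) (v : Vec nv) (η : S.Inputs) : ℝ :=
  wsq S.P (S.pred x η S.N - S.xEq v) +
    ∑ k : Fin S.N, (wsq S.Q (S.pred x η k.val - S.xEq v) + wsq S.R (η k - S.uEq v))

/-- `η` is a minimizer of the OCP with tightening `s`. -/
def IsOptimal (s : ℝ) (x : Vec nx) (v : Vec nv) (η : S.Inputs) : Prop :=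
  S.Feasible s x η ∧ ∀ η', S.Feasible s x η' → S.cost x v η ≤ S.cost x v η'

/-- The optimal value; meaningful for `x ∈ S.feasSet s`. -/
def value (s : ℝ) (x : Vec nx) (v : Vec nv) : ℝ :=
  sInf (S.cost x v '' {η | S.Feasible s x η})

/-- The square root of the optimal value; meaningful for `x ∈ S.feasSet s`. -/
def psi (s : ℝ) (x : Vec nx) (v : Vec nv) : ℝ := √(S.value s x v)

/-- The square root of the cost of a (suboptimal) input sequence. -/
def psiHat (x : Vec nx) (v : Vec nv) (η : S.Inputs) : ℝ := √(S.cost x v η)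

/-- The LQR gain. -/
def K : Matrix (Fin nu) (Fin nx) ℝ :=
  (S.R + S.B.transpose * S.P * S.B)⁻¹ * (S.B.transpose * S.P * S.A)

/-- The factor `d = N λ_min(Q) / λ_max(P) + 1`. -/
def d : ℝ := S.N * lamMin S.Q / lamMax S.P + 1

/-- The ellipsoid `Ω` around the equilibrium state of `v`. -/
def ellipsoid (p : ℝ) (v : Vec nv) : Set (Vec nx) := {x | wsq S.P (x - S.xEq v) ≤ p}

/-- The number `p` is an admissible level for the (implicit) terminal set of the OCP with
tightening `s`. -/
def TerminalLevel (s p : ℝ) (v : Vec nv) : Prop :=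
  0 < p ∧ S.ellipsoid p v ⊆
    {x | S.uEq v - mv S.K (x - S.xEq v) ∈ S.inputSet s ∧ x ∈ S.stateSet s}

/-- The region of attraction estimate `Γ` of the exact closed loop with tightening `s`. -/
def roaExact (s p : ℝ) (v : Vec nv) : Set (Vec nx) :=
  {x | x ∈ S.feasSet s ∧ S.psi s x v ≤ √(S.d * p)}

/-- The region of attraction estimate `Γ̌` of the inexact closed loop. -/
def roa (c : ℝ) (v : Vec nv) : Set (Vec nx) :=
  {x | x ∈ S.feasSet 0 ∧ S.psi 0 x v ≤ c}

/-- The parameters `s` (tightening cap), `p` (terminal level) and `c` (bound on `ψ⁰`) define a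
region of attraction estimate of the inexact closed loop at the reference `v`. -/
def AdmissibleROA (v : Vec nv) (s p c : ℝ) : Prop :=
  0 < s ∧ S.TerminalLevel s p v ∧ c ≤ √(S.d * p) ∧ S.roa c v ⊆ S.roaExact s p v

end Problem

/-- The constants of the analysis and of the tightening rule: the Lipschitz constants `β` and `φ`,
the parameters `π₁`, `π₂`, and the margin `σ` that all references have. -/
structure Constants where
  β : ℝ
  φ : ℝ
  π₁ : ℝ
  π₂ : ℝ
  σ : ℝ

section

variable {nx nu nv mx mu : ℕ} (S : Problem nx nu nv mx mu) (c : Constants)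

def alpha1 : ℝ := 1 - √(1 - lamMin S.Q / c.β ^ 2)

/-- The factor is `√(maxSing B)` if `maxSing B ≤ 1` and `maxSing B` otherwise. -/
def zeta1 : ℝ := max √(maxSing S.B) (maxSing S.B) * c.β * (c.φ + 1)

def alpha2 : ℝ := 1 - (c.π₁ + c.π₂ * maxSing S.B * (c.φ + 1))

/-- The smallest eigenvalue of the block diagonal weight with blocks `Q`, `P` and `R`. -/
def lamMinH : ℝ := min (lamMin S.Q) (min (lamMin S.P) (lamMin S.R))

def zeta2 : ℝ := c.π₂ * ((maxSing (S.A - 1) + maxSing S.B) / √(lamMinH S))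

/-- The standing assumptions on the MPC problem and on the constants. -/
structure Standing : Prop where
  /-- the columns of `(Gx, Gu)` are a basis of the null space of `[A - I, B]` -/
  equilibria : ∀ (x : Vec nx) (u : Vec nu),
    mv S.A x + mv S.B u = x ↔ ∃ v, S.xEq v = x ∧ S.uEq v = u
  equilibria_inj : Function.Injective fun v => (S.xEq v, S.uEq v)
  refs_compact : IsCompact S.refs
  refs_convex : Convex ℝ S.refs
  constraints_compact : IsCompact (S.stateSet 0 ×ˢ S.inputSet 0)
  origin_interior : ((0 : Vec nx), (0 : Vec nu)) ∈ interior (S.stateSet 0 ×ˢ S.inputSet 0)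
  Q_pos : S.Q.PosDef
  P_pos : S.P.PosDef
  R_pos : S.R.PosDef
  riccati : S.P = S.Q + S.A.transpose * S.P * S.A - S.A.transpose * S.P * S.B * S.K
  /-- the references keep a margin `σ` from the boundary of the constraints -/
  σ_pos : 0 < c.σ
  margin : ∀ v ∈ S.refs, (S.xEq v, S.uEq v) ∈ interior (S.stateSet c.σ ×ˢ S.inputSet c.σ)
  /-- `β` is a Lipschitz constant of `ψ` on the feasible parameters -/
  one_lt_β : 1 < c.β
  lipschitz_psi : ∀ s, 0 ≤ s → ∀ x ∈ S.feasSet s, ∀ x' ∈ S.feasSet s,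
    ∀ v ∈ S.refs, ∀ v' ∈ S.refs,
      |S.psi s x v - S.psi s x' v'| ≤ c.β * thetaDist x v x' v'
  /-- `φ` is a Lipschitz constant of the optimal first input in the tightening parameter -/
  lipschitz_input : ∀ s s', 0 ≤ s → 0 ≤ s' → ∀ x, ∀ v ∈ S.refs, ∀ η η' : S.Inputs,
    S.IsOptimal s x v η → S.IsOptimal s' x v η' →
      ‖S.firstInput η - S.firstInput η'‖ ≤ c.φ * |s - s'|
  π₁_pos : 0 < c.π₁
  π₁_lt : c.π₁ < 1
  π₂_pos : 0 < c.π₂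
  π₂_lt : c.π₂ < 1
  /-- the small gain conditions -/
  α₁_lt : alpha1 S c < 1
  α₂_pos : 0 < alpha2 S c
  α₂_lt : alpha2 S c < 1
  small_gain : zeta2 S c / alpha2 S c < alpha1 S c / zeta1 S c
  α₁_d : alpha1 S c * √S.d < 1

/-- The gain condition linking the tightening cap `s` and the bound `b` on `ψ⁰`. -/
def GainCondition (s b : ℝ) : Prop :=
  zeta1 S c / alpha1 S c * s ≤ b ∧ b ≤ alpha2 S c / zeta2 S c * s

/-- The invariance conditions for a change of the modified reference from `v` to `v'` when the
state and the tightening parameter are `x` and `s`, the new ones having the tightening parameter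
`s'`, terminal level `p'` and bound `b'`. -/
def InvarianceConditions (x : Vec nx) (v : Vec nv) (s : ℝ) (v' : Vec nv) (s' p' b' : ℝ) : Prop :=
  (c.β * ‖v' - v‖ + S.psi 0 x v + zeta1 S c * s ≤ b' ∧ b' ≤ √(S.d * p')) ∧
    GainCondition S c s' b'

/-- An iterative optimizer with states in `W`: the next iterate depends on the problem `(s, x, v)`
and on the iterates so far (latest first); every optimizer state yields an input sequence; the
iterates so far yield a primal residual and the quantity `gap` of the termination test. -/
structure Optimizer (W : Type*) where
  step : ℝ → Vec nx → Vec nv → List W → W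
  inputs : W → S.Inputs
  residual : ℝ → Vec nx → Vec nv → List W → ℝ
  gap : List W → ℝ

namespace Optimizer

variable {S} {W : Type*} (O : Optimizer S W)

/-- The iterates up to index `j`, latest first, from the initial value `w`. -/
def hist (s : ℝ) (x : Vec nx) (v : Vec nv) (w : W) : ℕ → List W
  | 0 => [w]
  | j + 1 => O.step s x v (hist s x v w j) :: hist s x v w j

/-- The iterate of index `j`. -/
def iter (s : ℝ) (x : Vec nx) (v : Vec nv) (w : W) : ℕ → W
  | 0 => w
  | j + 1 => O.step s x v (O.hist s x v w j)

/-- The optimizer stops at `j`, the first index at which the squared residual and the gap are at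
most the squared tightening parameter. -/
def StopsAt (s : ℝ) (x : Vec nx) (v : Vec nv) (w : W) (j : ℕ) : Prop :=
  IsLeast {j | O.gap (O.hist s x v w j) ≤ s ^ 2 ∧ O.residual s x v (O.hist s x v w j) ^ 2 ≤ s ^ 2} j

/-- The properties required of the optimizer: a residual of at most `s` at termination guarantees
the constraints without tightening; at termination the gap bounds the squared suboptimality of the
first input; the optimizer converges globally on feasible problems. -/
structure Valid : Prop where
  feasible : ∀ s, 0 < s → ∀ x ∈ S.feasSet s, ∀ v ∈ S.refs, ∀ w j, O.StopsAt s x v w j →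
    O.residual s x v (O.hist s x v w j) ≤ s → S.Feasible 0 x (O.inputs (O.iter s x v w j))
  gap_bound : ∀ s, 0 < s → ∀ x ∈ S.feasSet s, ∀ v ∈ S.refs, ∀ w j, O.StopsAt s x v w j →
    ∀ η, S.IsOptimal s x v η →
      ‖S.firstInput (O.inputs (O.iter s x v w j)) - S.firstInput η‖ ^ 2 ≤ O.gap (O.hist s x v w j)
  convergent : ∀ s, 0 < s → ∀ x ∈ S.feasSet s, ∀ v ∈ S.refs, ∀ w η, S.IsOptimal s x v η →
    Tendsto (fun j => O.inputs (O.iter s x v w j)) atTop (𝓝 η) ∧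
    Tendsto (fun j => O.residual s x v (O.hist s x v w j)) atTop (𝓝 0) ∧
    Tendsto (fun j => O.gap (O.hist s x v w j)) atTop (𝓝 0)

end Optimizer

/-- The quantities of the closed loop at one time instant: the plant state, the governor parameter,
the modified reference, the tightening parameter, the parameters `cap`, `p`, `bound` of the region
of attraction estimate in use, and the optimizer state at termination. -/
structure LoopState (nx nv : ℕ) (W : Type*) where
  x : Vec nx
  κ : ℝ
  v : Vec nv
  s : ℝ
  cap : ℝ
  p : ℝ
  bound : ℝ
  w : W

variable {S} {W : Type*} (O : Optimizer S W)

/-- The plant state after the first input computed by the optimizer has been applied. -/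
def nextState (z : LoopState nx nv W) : Vec nx :=
  mv S.A z.x + mv S.B (S.firstInput (O.inputs z.w))

/-- The optimizer, warm started at `w`, terminates on the problem at hand and returns `z.w`. -/
def Solves (w : W) (z : LoopState nx nv W) : Prop :=
  ∃ j, O.StopsAt z.s z.x z.v w j ∧ z.w = O.iter z.s z.x z.v w j

/-- Admissible initial conditions: the state and the tightening parameter lie in the invariant
set belonging to the initial modified reference. -/
def InitialOK (z : LoopState nx nv W) : Prop :=
  z.v ∈ S.refs ∧ S.AdmissibleROA z.v z.cap z.p z.bound ∧ GainCondition S c z.cap z.bound ∧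
    z.x ∈ S.roa z.bound z.v ∧ 0 < z.s ∧ z.s ≤ z.cap

/-- One time step of the closed loop with the computation governor and desired reference `r`:
the modified reference moves by the fraction `κ` towards `r`; if `κ = 0`, the tightening parameter
is updated by its difference equation; if `κ > 0`, it is reset to the cap of the new reference, and
the change of reference is subject to the invariance conditions. -/
def Step (r : Vec nv) (z z' : LoopState nx nv W) : Prop :=
  0 ≤ z'.κ ∧ z'.κ ≤ 1 ∧
  z'.v = z'.κ • (r - z.v) + z.v ∧
  z'.x = nextState O z ∧
  (z'.κ = 0 → z'.s = c.π₁ * z.s + c.π₂ * thetaDist z'.x z'.v z.x z.v ∧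
    z'.cap = z.cap ∧ z'.p = z.p ∧ z'.bound = z.bound) ∧
  (0 < z'.κ → z'.s = z'.cap ∧ S.AdmissibleROA z'.v z'.cap z'.p z'.bound ∧
    InvarianceConditions S c z.x z.v z.s z'.v z'.cap z'.p z'.bound) ∧
  Solves O z.w z'

/-- `z` is a closed-loop trajectory over the time instants `0, …, n` for the constant desired
reference `r`, the optimizer being initialized with `w` at time `0`. -/
def IsRun (r : Vec nv) (w : W) (n : ℕ) (z : ℕ → LoopState nx nv W) : Prop :=
  InitialOK (S := S) c (z 0) ∧ Solves O w (z 0) ∧ ∀ t < n, Step c O r (z t) (z (t + 1))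

/-- `z'` is a trajectory up to time `n` that coincides with `z` up to time `i'`, and in which the
reference is not modified at the times after `i'`. -/
def HoldsReference (r : Vec nv) (w : W) (z z' : ℕ → LoopState nx nv W) (i' n : ℕ) : Prop :=
  IsRun c O r w n z' ∧ (∀ t ≤ i', z' t = z t) ∧ ∀ t, i' < t → t ≤ n → (z' t).κ = 0

/-- The property defining `ε`: a suboptimal cost of at most `(β ε)²` implies that the present and
the next state are feasible for the OCP with tightening `σ`. -/
def SmallCostFeasible (ε : ℝ) : Prop :=
  ∀ z : LoopState nx nv W, z.v ∈ S.refs → (∃ w, Solves O w z) →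
    S.psiHat z.x z.v (O.inputs z.w) ≤ c.β * ε →
      z.x ∈ S.feasSet c.σ ∧ nextState O z ∈ S.feasSet c.σ

/-- At the time instant after `z`, the modified reference can be moved towards `r` by exactly `ε`,
with a tightening parameter `s`, a terminal level `p` and a bound `b` that satisfy the invariance
conditions, and the next state lies in the region of attraction estimate of the new reference. -/
def StepOfSizePossible (r : Vec nv) (ε : ℝ) (z : LoopState nx nv W) : Prop :=
  ∃ (κ : ℝ) (v : Vec nv) (s p b : ℝ),
    0 < κ ∧ κ ≤ 1 ∧ v = κ • (r - z.v) + z.v ∧ v ∈ S.refs ∧ ‖v - z.v‖ = ε ∧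
    s < c.σ ∧ S.AdmissibleROA v s p b ∧
    z.x ∈ S.feasSet 0 ∧ InvarianceConditions S c z.x z.v z.s v s p b ∧
    nextState O z ∈ S.roa b v

end

end CompGov

end

/-! The sublevel sets of `ψ⁰` and the tightening `s` form a small-gain interconnection. While the
reference is held, one step of the inexact closed loop gives `ψ⁺ ≤ (1 - α₁) ψ + ζ₁ s` and `s⁺ ≤ (1 -
α₂) s + ζ₂ ψ` (`nextState_psi_le`, `tightening_le`). The first inequality combines the descent of
the optimal cost under the exact minimizer (`Problem.descent`) with the Lipschitz bounds for the
input error; the second bounds the distance travelled in one step by `ψ` and `s`.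

These estimates hold on the set `ψ⁰ ≤ bound`, `s ≤ cap`, which the gain condition makes invariant
(`InitialOK.hold`). A feasibility question has to be settled first: the Lipschitz bound on `ψ⁰`
compares feasible states only, and the state reached by an inexact input is not known to be feasible
beforehand. Since the region of attraction estimate is feasible with a positive tightening,
feasibility propagates in short steps along a segment (`mem_feasSet_of_lipschitz`).

The small-gain condition provides a linear function `ψ + a s` that decays geometrically
(`exists_contraction`). After finitely many held steps `ψ + ζ₁ s ≤ β ε`, and moving the reference by
`ε` costs at most another `β ε`. So the new bound can be `2 β ε`. For small `ε` it is admissible at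
every reference, because compactness of the references yields one terminal level for all of them
with the full margin `σ` (`exists_terminalLevel`).

Part (a) needs no dynamics: a small cost places the state and its successor in that terminal
ellipsoid, where the LQR feedback is feasible (`mem_feasSet_of_cost_le`). -/

namespace CompGov

variable {m n l : ℕ}

/-! ### Weighted norms, spectral bounds and the Riccati identity -/

lemma mv_add (M : Matrix (Fin m) (Fin n) ℝ) (x y : Vec n) : mv M (x + y) = mv M x + mv M y :=
  map_add _ x y

lemma mv_sub (M : Matrix (Fin m) (Fin n) ℝ) (x y : Vec n) : mv M (x - y) = mv M x - mv M y :=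
  map_sub _ x y

lemma mv_neg (M : Matrix (Fin m) (Fin n) ℝ) (x : Vec n) : mv M (-x) = -mv M x :=
  map_neg _ x

lemma mv_zero (M : Matrix (Fin m) (Fin n) ℝ) : mv M 0 = 0 := map_zero _

lemma add_mv (M M' : Matrix (Fin m) (Fin n) ℝ) (x : Vec n) :
    mv (M + M') x = mv M x + mv M' x := by simp [mv]

lemma sub_mv (M M' : Matrix (Fin m) (Fin n) ℝ) (x : Vec n) :
    mv (M - M') x = mv M x - mv M' x := by simp [mv]

lemma one_mv (x : Vec n) : mv (1 : Matrix (Fin n) (Fin n) ℝ) x = x := by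
  ext i; simp [mv]

lemma mul_mv (M : Matrix (Fin m) (Fin n) ℝ) (M' : Matrix (Fin n) (Fin l) ℝ) (x : Vec l) :
    mv (M * M') x = mv M (mv M' x) := by
  ext i; simp [mv]

lemma continuous_mv (M : Matrix (Fin m) (Fin n) ℝ) : Continuous (mv M) :=
  (Matrix.toEuclideanLin M).continuous_of_finiteDimensional

lemma continuous_wsq (E : Matrix (Fin n) (Fin n) ℝ) : Continuous (wsq E) :=
  continuous_id.inner (continuous_mv E)

lemma norm_mv_le (M : Matrix (Fin m) (Fin n) ℝ) (x : Vec n) : ‖mv M x‖ ≤ maxSing M * ‖x‖ :=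
  (Matrix.toEuclideanLin M).toContinuousLinearMap.le_opNorm x

lemma maxSing_nonneg (M : Matrix (Fin m) (Fin n) ℝ) : 0 ≤ maxSing M := norm_nonneg _

lemma inner_mv_transpose (M : Matrix (Fin m) (Fin n) ℝ) (x : Vec n) (y : Vec m) :
    inner ℝ x (mv M.transpose y) = inner ℝ (mv M x) y := by
  have h := LinearMap.adjoint_inner_right (Matrix.toEuclideanLin M) x y
  rw [← Matrix.toEuclideanLin_conjTranspose_eq_adjoint] at h
  simpa [mv] using h

lemma inner_mv_symm {E : Matrix (Fin n) (Fin n) ℝ} (hE : E.IsHermitian) (x y : Vec n) :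
    inner ℝ x (mv E y) = inner ℝ y (mv E x) := by
  have h : E.transpose = E := by simpa using hE.eq
  rw [← h, inner_mv_transpose, h, real_inner_comm]

lemma wsq_eq_sum {E : Matrix (Fin n) (Fin n) ℝ} (hE : E.IsHermitian) (x : Vec n) :
    wsq E x = ∑ i, hE.eigenvalues i * inner ℝ (hE.eigenvectorBasis i) x ^ 2 := by
  rw [wsq, ← hE.eigenvectorBasis.sum_inner_mul_inner]
  refine Finset.sum_congr rfl fun i _ => ?_
  have h : mv E (hE.eigenvectorBasis i) = hE.eigenvalues i • hE.eigenvectorBasis i := by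
    ext j
    have := congrFun (hE.mulVec_eigenvectorBasis i) j
    simpa [mv, Matrix.toLpLin_apply] using this
  rw [inner_mv_symm hE, h, inner_smul_right, real_inner_comm]
  ring

lemma norm_sq_eq_sum {E : Matrix (Fin n) (Fin n) ℝ} (hE : E.IsHermitian) (x : Vec n) :
    ‖x‖ ^ 2 = ∑ i, inner ℝ (hE.eigenvectorBasis i) x ^ 2 := by
  rw [← real_inner_self_eq_norm_sq, ← hE.eigenvectorBasis.sum_inner_mul_inner]
  refine Finset.sum_congr rfl fun i _ => ?_
  rw [real_inner_comm]
  ring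

lemma lamMin_mul_le_wsq {E : Matrix (Fin n) (Fin n) ℝ} (hE : E.IsHermitian) (x : Vec n) :
    lamMin E * ‖x‖ ^ 2 ≤ wsq E x := by
  rw [wsq_eq_sum hE, norm_sq_eq_sum hE, Finset.mul_sum]
  refine Finset.sum_le_sum fun i _ => mul_le_mul_of_nonneg_right ?_ (sq_nonneg _)
  rw [lamMin, hE.spectrum_real_eq_range_eigenvalues]
  exact csInf_le (Set.finite_range _).bddBelow ⟨i, rfl⟩

lemma wsq_le_lamMax_mul {E : Matrix (Fin n) (Fin n) ℝ} (hE : E.IsHermitian) (x : Vec n) :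
    wsq E x ≤ lamMax E * ‖x‖ ^ 2 := by
  rw [wsq_eq_sum hE, norm_sq_eq_sum hE, Finset.mul_sum]
  refine Finset.sum_le_sum fun i _ => mul_le_mul_of_nonneg_right ?_ (sq_nonneg _)
  rw [lamMax, hE.spectrum_real_eq_range_eigenvalues]
  exact le_csSup (Set.finite_range _).bddAbove ⟨i, rfl⟩

lemma lamMin_pos [NeZero n] {E : Matrix (Fin n) (Fin n) ℝ} (hE : E.PosDef) : 0 < lamMin E := by
  rw [lamMin, hE.isHermitian.spectrum_real_eq_range_eigenvalues]
  obtain ⟨i, hi⟩ := (Set.range_nonempty hE.isHermitian.eigenvalues).csInf_mem (Set.finite_range _)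
  rw [← hi]
  exact hE.eigenvalues_pos i

lemma lamMax_pos [NeZero n] {E : Matrix (Fin n) (Fin n) ℝ} (hE : E.PosDef) : 0 < lamMax E := by
  rw [lamMax, hE.isHermitian.spectrum_real_eq_range_eigenvalues]
  obtain ⟨i, hi⟩ := (Set.range_nonempty hE.isHermitian.eigenvalues).csSup_mem (Set.finite_range _)
  rw [← hi]
  exact hE.eigenvalues_pos i

lemma wsq_nonneg {E : Matrix (Fin n) (Fin n) ℝ} (hE : E.PosDef) (x : Vec n) : 0 ≤ wsq E x := by
  rw [wsq_eq_sum hE.isHermitian]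
  exact Finset.sum_nonneg fun i _ => mul_nonneg (hE.eigenvalues_pos i).le (sq_nonneg _)

lemma wsq_zero (E : Matrix (Fin n) (Fin n) ℝ) : wsq E 0 = 0 := by simp [wsq]

lemma wsq_add {E : Matrix (Fin n) (Fin n) ℝ} (hE : E.IsHermitian) (x y : Vec n) :
    wsq E (x + y) = wsq E x + 2 * inner ℝ x (mv E y) + wsq E y := by
  rw [wsq, mv_add, inner_add_left, inner_add_right, inner_add_right, inner_mv_symm hE y x]
  simp only [wsq]; ring

/-- The Riccati equation in terms of the closed loop: one step of the LQR feedback decreases the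
terminal cost by the stage cost. -/
lemma lqr_step {nx nu nv mx mu : ℕ} {S : Problem nx nu nv mx mu} {c : Constants}
    (hS : Standing S c) (x : Vec nx) :
    wsq S.Q x + wsq S.R (-mv S.K x) + wsq S.P (mv S.A x + mv S.B (-mv S.K x)) = wsq S.P x := by
  have hM : (S.R + S.B.transpose * S.P * S.B).PosDef := by
    refine hS.R_pos.add_posSemidef ?_
    simpa using hS.P_pos.posSemidef.conjTranspose_mul_mul_same S.B
  -- `R + BᵀPB` is positive definite, hence invertible, so `K` satisfies the normal equations.
  -- Pairing them with `K x`, and the Riccati equation with `x`, leaves only an identity between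
  -- inner products.
  have hK : (S.R + S.B.transpose * S.P * S.B) * S.K = S.B.transpose * S.P * S.A := by
    rw [Problem.K, ← Matrix.mul_assoc,
      Matrix.mul_nonsing_inv _ ((Matrix.isUnit_iff_isUnit_det _).1 hM.isUnit), Matrix.one_mul]
  have hK' := congrArg (fun M => inner ℝ (mv S.K x) (mv M x)) hK
  have hP := congrArg (fun M => inner ℝ x (mv M x)) hS.riccati
  simp only [mul_mv, add_mv, sub_mv, inner_add_right, inner_sub_right, inner_mv_transpose]
    at hK' hP
  rw [wsq_add hS.P_pos.isHermitian]
  simp only [wsq, mv_neg, inner_neg_left, inner_neg_right]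
  linarith [inner_mv_symm hS.P_pos.isHermitian (mv S.A x) (mv S.B (mv S.K x))]

end CompGov

/-! ### Predicted trajectories and constraint sets -/

namespace CompGov

namespace Problem

variable {nx nu nv mx mu : ℕ} (S : Problem nx nu nv mx mu)

/-- The extension of an input sequence over the horizon by zero. -/
def ext (η : S.Inputs) (k : ℕ) : Vec nu := if h : k < S.N then η ⟨k, h⟩ else 0

/-- The restriction of an infinite input sequence to the horizon. -/
def restrict (u : ℕ → Vec nu) : S.Inputs := fun k => u k

/-- The plant states from `x` under an infinite input sequence. -/
noncomputable def traj (x : Vec nx) (u : ℕ → Vec nu) : ℕ → Vec nx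
  | 0 => x
  | k + 1 => mv S.A (traj x u k) + mv S.B (u k)

/-- The stage cost. -/
noncomputable def stage (v : Vec nv) (x : Vec nx) (u : Vec nu) : ℝ :=
  wsq S.Q (x - S.xEq v) + wsq S.R (u - S.uEq v)

/-- The LQR feedback around the equilibrium of `v`. -/
noncomputable def lqr (v : Vec nv) (x : Vec nx) : Vec nu := S.uEq v - mv S.K (x - S.xEq v)

/-- The states from `x` when `u` is applied before time `k` and the LQR feedback from then on. -/
noncomputable def switchTraj (v : Vec nv) (k : ℕ) (x : Vec nx) (u : ℕ → Vec nu) : ℕ → Vec nx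
  | 0 => x
  | j + 1 => mv S.A (switchTraj v k x u j) +
      mv S.B (if j < k then u j else S.lqr v (switchTraj v k x u j))

/-- The inputs from `x` when `u` is applied before time `k` and the LQR feedback from then on. -/
noncomputable def switchInput (v : Vec nv) (k : ℕ) (x : Vec nx) (u : ℕ → Vec nu) (j : ℕ) :
    Vec nu :=
  if j < k then u j else S.lqr v (S.switchTraj v k x u j)

variable {S}

/-- Sequences indexed by `ℕ` can be shifted and prolonged freely. Extension by zero agrees with the
convention of `pred` beyond the horizon. -/
lemma pred_eq_traj (x : Vec nx) (η : S.Inputs) (k : ℕ) : S.pred x η k = S.traj x (S.ext η) k := by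
  induction k with
  | zero => rfl
  | succ k ih =>
    rw [pred, traj, ih, ext]
    split_ifs <;> simp [mv_zero]

lemma ext_restrict {u : ℕ → Vec nu} {k : ℕ} (hk : k < S.N) : S.ext (S.restrict u) k = u k := by
  simp [ext, restrict, hk]

lemma restrict_ext (η : S.Inputs) : S.restrict (S.ext η) = η := by
  funext k; simp [ext, restrict]

lemma traj_congr {x : Vec nx} {u u' : ℕ → Vec nu} {k : ℕ} (h : ∀ j < k, u j = u' j) :
    S.traj x u k = S.traj x u' k := by
  induction k with
  | zero => rfl
  | succ k ih => rw [traj, traj, ih fun j hj => h j (by omega), h k (by omega)]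

lemma pred_restrict {x : Vec nx} {u : ℕ → Vec nu} {k : ℕ} (hk : k ≤ S.N) :
    S.pred x (S.restrict u) k = S.traj x u k := by
  rw [pred_eq_traj]
  exact traj_congr fun j hj => ext_restrict (by omega)

lemma traj_shift (x : Vec nx) (u : ℕ → Vec nu) (k : ℕ) :
    S.traj (S.traj x u 1) (fun j => u (j + 1)) k = S.traj x u (k + 1) := by
  induction k with
  | zero => rfl
  | succ k ih =>
    rw [traj, ih]
    rfl

lemma feasible_restrict {s : ℝ} {x : Vec nx} {u : ℕ → Vec nu} :
    S.Feasible s x (S.restrict u) ↔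
      ∀ k < S.N, u k ∈ S.inputSet s ∧ S.traj x u (k + 1) ∈ S.stateSet s := by
  constructor
  · intro h k hk
    refine ⟨h.1 ⟨k, hk⟩, ?_⟩
    rw [← pred_restrict hk]
    exact h.2 ⟨k, hk⟩
  · intro h
    refine ⟨fun k => (h k k.2).1, fun k => ?_⟩
    rw [pred_restrict k.2]
    exact (h k k.2).2

lemma feasible_iff {s : ℝ} {x : Vec nx} {η : S.Inputs} :
    S.Feasible s x η ↔
      ∀ k < S.N, S.ext η k ∈ S.inputSet s ∧ S.traj x (S.ext η) (k + 1) ∈ S.stateSet s := by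
  rw [← feasible_restrict, restrict_ext]

lemma cost_restrict (x : Vec nx) (v : Vec nv) (u : ℕ → Vec nu) :
    S.cost x v (S.restrict u) = wsq S.P (S.traj x u S.N - S.xEq v) +
      ∑ k ∈ Finset.range S.N, S.stage v (S.traj x u k) (u k) := by
  rw [cost, pred_restrict le_rfl, Finset.sum_range]
  congr 1
  refine Finset.sum_congr rfl fun k _ => ?_
  rw [pred_restrict k.2.le]
  rfl

lemma cost_eq (x : Vec nx) (v : Vec nv) (η : S.Inputs) :
    S.cost x v η = wsq S.P (S.traj x (S.ext η) S.N - S.xEq v) +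
      ∑ k ∈ Finset.range S.N, S.stage v (S.traj x (S.ext η) k) (S.ext η k) := by
  rw [← cost_restrict, restrict_ext]

lemma traj_switchInput (v : Vec nv) (k : ℕ) (x : Vec nx) (u : ℕ → Vec nu) (j : ℕ) :
    S.traj x (S.switchInput v k x u) j = S.switchTraj v k x u j := by
  induction j with
  | zero => rfl
  | succ j ih => rw [traj, ih, switchTraj]; rfl

lemma switchInput_of_lt {v : Vec nv} {k : ℕ} {x : Vec nx} {u : ℕ → Vec nu} {j : ℕ} (h : j < k) :
    S.switchInput v k x u j = u j := if_pos h

lemma switchTraj_of_le {v : Vec nv} {k : ℕ} {x : Vec nx} {u : ℕ → Vec nu} {j : ℕ} (h : j ≤ k) :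
    S.switchTraj v k x u j = S.traj x u j := by
  rw [← traj_switchInput]
  exact traj_congr fun i hi => switchInput_of_lt (by omega)

lemma switchInput_of_ge {v : Vec nv} {k : ℕ} {x : Vec nx} {u : ℕ → Vec nu} {j : ℕ} (h : k ≤ j) :
    S.switchInput v k x u j = S.lqr v (S.switchTraj v k x u j) := if_neg (by omega)

lemma switchTraj_succ_of_ge {v : Vec nv} {k : ℕ} {x : Vec nx} {u : ℕ → Vec nu} {j : ℕ}
    (h : k ≤ j) : S.switchTraj v k x u (j + 1) =
      mv S.A (S.switchTraj v k x u j) + mv S.B (S.lqr v (S.switchTraj v k x u j)) := by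
  rw [switchTraj, if_neg (by omega)]

lemma inputSet_anti {s s' : ℝ} (h : s ≤ s') : S.inputSet s' ⊆ S.inputSet s :=
  fun _ hu j => ⟨by linarith [(hu j).1], by linarith [(hu j).2]⟩

lemma stateSet_anti {s s' : ℝ} (h : s ≤ s') : S.stateSet s' ⊆ S.stateSet s :=
  fun _ hu j => ⟨by linarith [(hu j).1], by linarith [(hu j).2]⟩

lemma Feasible.anti {s s' : ℝ} (h : s ≤ s') {x : Vec nx} {η : S.Inputs}
    (hη : S.Feasible s' x η) : S.Feasible s x η :=
  ⟨fun k => inputSet_anti h (hη.1 k), fun k => stateSet_anti h (hη.2 k)⟩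

lemma feasSet_anti {s s' : ℝ} (h : s ≤ s') : S.feasSet s' ⊆ S.feasSet s :=
  fun _ ⟨η, hη⟩ => ⟨η, hη.anti h⟩

lemma TerminalLevel.anti {s s' p : ℝ} (h : s ≤ s') {v : Vec nv} (hp : S.TerminalLevel s' p v) :
    S.TerminalLevel s p v :=
  ⟨hp.1, fun _ hx => ⟨inputSet_anti h (hp.2 hx).1, stateSet_anti h (hp.2 hx).2⟩⟩

variable {c : Constants}

/-! ### Switching to the LQR feedback -/

lemma equilibrium (hS : Standing S c) (v : Vec nv) :
    mv S.A (S.xEq v) + mv S.B (S.uEq v) = S.xEq v :=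
  (hS.equilibria _ _).2 ⟨v, rfl, rfl⟩

lemma next_sub_xEq (hS : Standing S c) (v : Vec nv) (x : Vec nx) (u : Vec nu) :
    mv S.A x + mv S.B u - S.xEq v = mv S.A (x - S.xEq v) + mv S.B (u - S.uEq v) := by
  rw [mv_sub, mv_sub]
  nth_rw 1 [← equilibrium hS v]
  abel

lemma stage_nonneg (hS : Standing S c) (v : Vec nv) (x : Vec nx) (u : Vec nu) :
    0 ≤ S.stage v x u :=
  add_nonneg (wsq_nonneg hS.Q_pos _) (wsq_nonneg hS.R_pos _)

lemma stage_lqr (hS : Standing S c) (v : Vec nv) (x : Vec nx) :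
    S.stage v x (S.lqr v x) + wsq S.P (mv S.A x + mv S.B (S.lqr v x) - S.xEq v) =
      wsq S.P (x - S.xEq v) := by
  rw [← lqr_step hS (x - S.xEq v), next_sub_xEq hS, stage]
  simp [lqr]

lemma lqr_mem_ellipsoid (hS : Standing S c) {v : Vec nv} {p : ℝ} {x : Vec nx}
    (hx : x ∈ S.ellipsoid p v) : mv S.A x + mv S.B (S.lqr v x) ∈ S.ellipsoid p v := by
  have h1 := stage_lqr hS v x
  have h2 := stage_nonneg hS v x (S.lqr v x)
  simp only [ellipsoid, Set.mem_ofPred_eq] at hx ⊢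
  linarith

lemma switchTraj_mem_ellipsoid (hS : Standing S c) {v : Vec nv} {p : ℝ} {k : ℕ} {x : Vec nx}
    {u : ℕ → Vec nu} (hx : S.traj x u k ∈ S.ellipsoid p v) {j : ℕ} (hj : k ≤ j) :
    S.switchTraj v k x u j ∈ S.ellipsoid p v := by
  induction j, hj using Nat.le_induction with
  | base => rwa [switchTraj_of_le le_rfl]
  | succ j hj ih =>
    rw [switchTraj_succ_of_ge hj]
    exact lqr_mem_ellipsoid hS ih

/-- By `stage_lqr` each LQR step pays its stage cost exactly out of the terminal cost. The total
therefore telescopes and does not depend on how long the LQR tail is. -/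
lemma switch_cost (hS : Standing S c) (v : Vec nv) {k : ℕ} (x : Vec nx) (u : ℕ → Vec nu)
    {n : ℕ} (hn : k ≤ n) :
    wsq S.P (S.switchTraj v k x u n - S.xEq v) +
        ∑ j ∈ Finset.range n, S.stage v (S.switchTraj v k x u j) (S.switchInput v k x u j) =
      wsq S.P (S.traj x u k - S.xEq v) +
        ∑ j ∈ Finset.range k, S.stage v (S.traj x u j) (u j) := by
  induction n, hn using Nat.le_induction with
  | base =>
    rw [switchTraj_of_le le_rfl]
    congr 1
    refine Finset.sum_congr rfl fun j hj => ?_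
    rw [Finset.mem_range] at hj
    rw [switchTraj_of_le hj.le, switchInput_of_lt hj]
  | succ n hn ih =>
    rw [← ih, Finset.sum_range_succ, switchInput_of_ge hn, switchTraj_succ_of_ge hn,
      ← stage_lqr hS v (S.switchTraj v k x u n)]
    ring

lemma switch_feasible (hS : Standing S c) {s p : ℝ} {v : Vec nv} (hp : S.TerminalLevel s p v)
    {k : ℕ} {x : Vec nx} {u : ℕ → Vec nu} (hx : S.traj x u k ∈ S.ellipsoid p v)
    (hu : ∀ j < k, u j ∈ S.inputSet s ∧ S.traj x u (j + 1) ∈ S.stateSet s) (j : ℕ) :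
    S.switchInput v k x u j ∈ S.inputSet s ∧ S.switchTraj v k x u (j + 1) ∈ S.stateSet s := by
  rcases lt_or_ge j k with h | h
  · rw [switchInput_of_lt h, switchTraj_of_le h]
    exact hu j h
  · rw [switchInput_of_ge h]
    exact ⟨(hp.2 (switchTraj_mem_ellipsoid hS hx h)).1,
      (hp.2 (switchTraj_mem_ellipsoid hS hx (h.trans (Nat.le_succ j)))).2⟩

/-- On a terminal ellipsoid the OCP is feasible, at most at the terminal cost. -/
lemma exists_feasible_of_mem_ellipsoid (hS : Standing S c) {s p : ℝ} {v : Vec nv}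
    (hp : S.TerminalLevel s p v) {x : Vec nx} (hx : x ∈ S.ellipsoid p v) :
    ∃ η, S.Feasible s x η ∧ S.cost x v η = wsq S.P (x - S.xEq v) := by
  have hx' : S.traj x 0 0 ∈ S.ellipsoid p v := hx
  refine ⟨S.restrict (S.switchInput v 0 x 0), ?_, ?_⟩
  · rw [feasible_restrict]
    intro k _
    rw [traj_switchInput]
    exact switch_feasible hS hp hx' (fun j hj => absurd hj (by omega)) k
  · rw [cost_restrict]
    simp only [traj_switchInput]
    rw [switch_cost hS v x 0 (Nat.zero_le _)]
    simp [traj]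

lemma cost_nonneg (hS : Standing S c) (x : Vec nx) (v : Vec nv) (η : S.Inputs) :
    0 ≤ S.cost x v η := by
  rw [cost_eq]
  exact add_nonneg (wsq_nonneg hS.P_pos _) (Finset.sum_nonneg fun k _ => stage_nonneg hS _ _ _)

lemma stage_zero_le_cost (hS : Standing S c) (x : Vec nx) (v : Vec nv) (η : S.Inputs) :
    wsq S.Q (x - S.xEq v) + wsq S.R (S.firstInput η - S.uEq v) ≤ S.cost x v η := by
  have h := Finset.single_le_sum (f := fun k => S.stage v (S.traj x (S.ext η) k) (S.ext η k))
    (fun k _ => stage_nonneg hS _ _ _) (Finset.mem_range.2 S.N_pos)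
  have h0 : S.ext η 0 = S.firstInput η := by simp [ext, firstInput, S.N_pos]
  rw [cost_eq]
  have := wsq_nonneg hS.P_pos (S.traj x (S.ext η) S.N - S.xEq v)
  simp only [h0, traj, stage] at h ⊢
  linarith

/-! ### Existence of minimizers and descent of the optimal cost -/

lemma continuous_pred (x : Vec nx) (k : ℕ) : Continuous fun η : S.Inputs => S.pred x η k := by
  induction k with
  | zero => exact continuous_const
  | succ k ih =>
    simp only [pred]
    refine ((continuous_mv _).comp ih).add ?_
    split_ifs with h
    · exact (continuous_mv _).comp (continuous_apply _)
    · exact continuous_const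

lemma continuous_cost (x : Vec nx) (v : Vec nv) : Continuous (S.cost x v) := by
  unfold cost
  refine ((continuous_wsq _).comp ((continuous_pred x _).sub continuous_const)).add ?_
  refine continuous_finsetSum _ fun k _ => ?_
  exact ((continuous_wsq _).comp ((continuous_pred x _).sub continuous_const)).add
    ((continuous_wsq _).comp ((continuous_apply k).sub continuous_const))

lemma isClosed_inputSet (s : ℝ) : IsClosed (S.inputSet s) := by
  have h (j : Fin mu) : Continuous fun u : Vec nu => mv S.D u j :=
    (EuclideanSpace.proj j).continuous.comp (continuous_mv S.D)
  simp only [inputSet, Set.ofPred_forall]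
  exact isClosed_iInter fun j => (isClosed_le continuous_const (h j)).inter
    (isClosed_le (h j) continuous_const)

lemma isClosed_stateSet (s : ℝ) : IsClosed (S.stateSet s) := by
  have h (j : Fin mx) : Continuous fun u : Vec nx => mv S.C u j :=
    (EuclideanSpace.proj j).continuous.comp (continuous_mv S.C)
  simp only [stateSet, Set.ofPred_forall]
  exact isClosed_iInter fun j => (isClosed_le continuous_const (h j)).inter
    (isClosed_le (h j) continuous_const)

lemma isCompact_inputSet (hS : Standing S c) : IsCompact (S.inputSet 0) := by
  have h := hS.constraints_compact.image continuous_snd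
  rwa [Set.snd_image_prod] at h
  -- The projection of the compact product is the whole input set because the state factor contains
  -- the origin.
  exact ⟨0, (Set.mem_prod.1 (interior_subset hS.origin_interior)).1⟩

/-- The input constraints confine the feasible sequences to a compact product, on which the cost is
continuous. -/
lemma exists_isOptimal (hS : Standing S c) {s : ℝ} (hs : 0 ≤ s) {x : Vec nx} (v : Vec nv)
    (hx : x ∈ S.feasSet s) : ∃ η, S.IsOptimal s x v η := by
  have hcomp : IsCompact {η : S.Inputs | S.Feasible s x η} := by
    refine (isCompact_univ_pi fun _ : Fin S.N => isCompact_inputSet hS).of_isClosed_subset ?_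
      fun η hη k _ => inputSet_anti hs (hη.1 k)
    simp only [Feasible, Set.ofPred_and, Set.ofPred_forall]
    refine IsClosed.inter (isClosed_iInter fun k => ?_) (isClosed_iInter fun k => ?_)
    · exact (isClosed_inputSet s).preimage (continuous_apply k)
    · exact (isClosed_stateSet s).preimage (continuous_pred x _)
  obtain ⟨η, hη, hmin⟩ := hcomp.exists_isMinOn hx (continuous_cost x v).continuousOn
  exact ⟨η, hη, fun η' hη' => hmin hη'⟩

lemma value_le (hS : Standing S c) {s : ℝ} {x : Vec nx} (v : Vec nv) {η : S.Inputs}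
    (hη : S.Feasible s x η) : S.value s x v ≤ S.cost x v η :=
  csInf_le ⟨0, by rintro _ ⟨η', -, rfl⟩; exact cost_nonneg hS x v η'⟩ ⟨η, hη, rfl⟩

lemma IsOptimal.value_eq {s : ℝ} {x : Vec nx} {v : Vec nv} {η : S.Inputs}
    (hη : S.IsOptimal s x v η) : S.value s x v = S.cost x v η :=
  IsLeast.csInf_eq ⟨⟨η, hη.1, rfl⟩, by rintro _ ⟨η', h, rfl⟩; exact hη.2 η' h⟩

lemma psi_nonneg (s : ℝ) (x : Vec nx) (v : Vec nv) : 0 ≤ S.psi s x v := Real.sqrt_nonneg _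

lemma IsOptimal.psi_sq (hS : Standing S c) {s : ℝ} {x : Vec nx} {v : Vec nv} {η : S.Inputs}
    (hη : S.IsOptimal s x v η) : S.psi s x v ^ 2 = S.cost x v η := by
  rw [psi, hη.value_eq, Real.sq_sqrt (cost_nonneg hS x v η)]

lemma psi_sq_le (hS : Standing S c) {s : ℝ} {x : Vec nx} (v : Vec nv) {η : S.Inputs}
    (hη : S.Feasible s x η) : S.psi s x v ^ 2 ≤ S.cost x v η := by
  rw [psi, Real.sq_sqrt']
  exact max_le (value_le hS v hη) (cost_nonneg hS x v η)

/-- If the optimal cost is at most `d p`, then the optimal terminal state lies in the terminal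
ellipsoid, although this is not imposed as a constraint. -/
lemma terminal_mem_ellipsoid [NeZero nx] (hS : Standing S c) {s p : ℝ} {v : Vec nv}
    (hp : S.TerminalLevel s p v) {x : Vec nx} {η : S.Inputs} (hη : S.IsOptimal s x v η)
    (hcost : S.cost x v η ≤ S.d * p) :
    S.traj x (S.ext η) S.N ∈ S.ellipsoid p v := by
  set u := S.ext η with hu
  by_contra hN
  -- If some predicted state were in the ellipsoid, switching to LQR there would be a feasible
  -- competitor. Optimality would then bound the terminal cost of the optimal sequence by the one at
  -- the switching time, hence by `p`.
  have hall : ∀ k ≤ S.N, p < wsq S.P (S.traj x u k - S.xEq v) := by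
    intro k hk
    by_contra hle
    have hmem : S.traj x u k ∈ S.ellipsoid p v := not_lt.1 hle
    have hfeas : S.Feasible s x (S.restrict (S.switchInput v k x u)) := by
      rw [feasible_restrict]
      intro j _
      rw [traj_switchInput]
      exact switch_feasible hS hp hmem (fun j hj => feasible_iff.1 hη.1 j (by omega)) j
    have hopt := hη.2 _ hfeas
    rw [cost_restrict, cost_eq] at hopt
    simp only [traj_switchInput] at hopt
    rw [switch_cost hS v x u hk, ← hu] at hopt
    have hsum : ∑ j ∈ Finset.range k, S.stage v (S.traj x u j) (u j) ≤
        ∑ j ∈ Finset.range S.N, S.stage v (S.traj x u j) (u j) :=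
      Finset.sum_le_sum_of_subset_of_nonneg (Finset.range_mono hk)
        fun _ _ _ => stage_nonneg hS _ _ _
    apply hN
    simp only [ellipsoid, Set.mem_ofPred_eq] at hmem ⊢
    linarith
  have hlP := lamMax_pos hS.P_pos
  have hlQ := lamMin_pos hS.Q_pos
  -- With all states outside the ellipsoid, each of the `N` stages costs at least `λ_min(Q) p /
  -- λ_max(P)` and the terminal cost exceeds `p`. The total exceeds `d p`; this is where the formula
  -- for `d` comes from.
  have hstage : ∀ k ∈ Finset.range S.N,
      lamMin S.Q * p / lamMax S.P ≤ S.stage v (S.traj x u k) (u k) := by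
    intro k hk
    have h1 := (hall k (Finset.mem_range.1 hk).le).le.trans
      (wsq_le_lamMax_mul hS.P_pos.isHermitian _)
    have h2 := lamMin_mul_le_wsq hS.Q_pos.isHermitian (S.traj x u k - S.xEq v)
    have h3 := wsq_nonneg hS.R_pos (u k - S.uEq v)
    have h4 : lamMin S.Q * p / lamMax S.P ≤ lamMin S.Q * ‖S.traj x u k - S.xEq v‖ ^ 2 := by
      rw [div_le_iff₀ hlP, mul_assoc, mul_comm (_ ^ 2)]
      exact mul_le_mul_of_nonneg_left h1 hlQ.le
    rw [stage]
    linarith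
  have hsum := Finset.sum_le_sum hstage
  have hterm := hall S.N le_rfl
  rw [cost_eq, ← hu] at hcost
  simp only [Finset.sum_const, Finset.card_range, nsmul_eq_mul] at hsum
  have : S.d * p = S.N * (lamMin S.Q * p / lamMax S.P) + p := by rw [d]; ring
  linarith

/-- Descent of the optimal cost along the exact closed loop. -/
lemma descent [NeZero nx] (hS : Standing S c) {s p : ℝ} {v : Vec nv}
    (hp : S.TerminalLevel s p v) {x : Vec nx} {η : S.Inputs} (hη : S.IsOptimal s x v η)
    (hcost : S.cost x v η ≤ S.d * p) :
    ∃ η', S.Feasible s (mv S.A x + mv S.B (S.firstInput η)) η' ∧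
      S.cost (mv S.A x + mv S.B (S.firstInput η)) v η' ≤
        S.cost x v η - wsq S.Q (x - S.xEq v) := by
  have hmem := terminal_mem_ellipsoid hS hp hη hcost
  set u := S.ext η with hu
  have h0 : u 0 = S.firstInput η := by simp [hu, ext, firstInput, S.N_pos]
  set w := S.switchInput v S.N x u with hw
  have hw0 : w 0 = S.firstInput η := by rw [← h0, hw, switchInput_of_lt S.N_pos]
  have hx1 : mv S.A x + mv S.B (S.firstInput η) = S.traj x w 1 := by
    rw [← hw0]; rfl
  refine ⟨S.restrict fun j => w (j + 1), ?_, ?_⟩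
  · rw [hx1, feasible_restrict]
    intro k _
    rw [traj_shift, traj_switchInput]
    exact switch_feasible hS hp hmem (feasible_iff.1 hη.1) (k + 1)
  -- Over `N + 1` steps the optimal sequence prolonged by one LQR step has exactly the optimal cost;
  -- dropping its first stage saves at least the `Q`-term of `x`.
  · have h := switch_cost hS v x u (Nat.le_succ S.N)
    rw [Finset.sum_range_succ', ← hw] at h
    rw [hx1, cost_restrict, cost_eq]
    have ht (j : ℕ) : S.traj (S.traj x w 1) (fun j => w (j + 1)) j =
        S.switchTraj v S.N x u (j + 1) := (traj_shift x w j).trans (traj_switchInput v S.N x u _)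
    simp only [ht]
    have hs : wsq S.Q (x - S.xEq v) ≤ S.stage v (S.switchTraj v S.N x u 0) (w 0) := by
      have := wsq_nonneg hS.R_pos (w 0 - S.uEq v)
      rw [stage, switchTraj]
      linarith
    linarith

end Problem

end CompGov

/-! ### Consequences of the standing assumptions -/

namespace CompGov

variable {nx nu nv mx mu : ℕ} {S : Problem nx nu nv mx mu} {c : Constants}

lemma thetaDist_same_ref (x x' : Vec nx) (v : Vec nv) : thetaDist x v x' v = ‖x - x'‖ := by
  simp [thetaDist]

lemma thetaDist_same_state (x : Vec nx) (v v' : Vec nv) : thetaDist x v x v' = ‖v - v'‖ := by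
  simp [thetaDist]

/-- For `B = 0` one has `ζ₁ = 0`, and division by zero turns the right side of the small-gain
condition into `0`, while the left side is nonnegative. Positivity excludes the dimensions `nx = 0`
and `nu = 0`, in which `lamMin` is the infimum of an empty set. -/
lemma maxSing_B_pos (hS : Standing S c) : 0 < maxSing S.B := by
  refine (maxSing_nonneg _).lt_of_ne fun h => ?_
  have h1 : zeta1 S c = 0 := by simp [zeta1, ← h]
  have h2 : 0 ≤ zeta2 S c :=
    mul_nonneg hS.π₂_pos.le (div_nonneg (add_nonneg (maxSing_nonneg _) (maxSing_nonneg _))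
      (Real.sqrt_nonneg _))
  have h3 := hS.small_gain
  rw [h1, div_zero] at h3
  exact absurd h3 (not_lt.2 (div_nonneg h2 hS.α₂_pos.le))

lemma neZero_nx (hS : Standing S c) : NeZero nx := by
  refine ⟨fun h => (maxSing_B_pos hS).ne' ?_⟩
  subst h
  rw [maxSing, norm_eq_zero]
  ext x i
  exact i.elim0

lemma neZero_nu (hS : Standing S c) : NeZero nu := by
  refine ⟨fun h => (maxSing_B_pos hS).ne' ?_⟩
  subst h
  rw [maxSing, norm_eq_zero]
  ext x i
  rw [Subsingleton.elim x 0]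
  simp

lemma norm_le_of_wsq_le {n : ℕ} {E : Matrix (Fin n) (Fin n) ℝ} (hE : E.PosDef)
    (h0 : 0 < lamMin E) {x : Vec n} {q : ℝ} (hq : 0 ≤ q) (h : wsq E x ≤ lamMin E * q ^ 2) :
    ‖x‖ ≤ q := by
  have h1 := (lamMin_mul_le_wsq hE.isHermitian x).trans h
  exact (pow_le_pow_iff_left₀ (norm_nonneg _) hq two_ne_zero).1 (le_of_mul_le_mul_left h1 h0)

/-- A common terminal level for all references. -/
lemma exists_terminalLevel [NeZero nx] (hS : Standing S c) :
    ∃ p, 0 < p ∧ ∀ v ∈ S.refs, S.TerminalLevel c.σ p v := by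
  have hcont : Continuous fun v => (S.xEq v, S.uEq v) :=
    (continuous_mv S.Gx).prodMk (continuous_mv S.Gu)
  obtain ⟨δ, hδ, hsub⟩ := (hS.refs_compact.image hcont).exists_thickening_subset_open
    isOpen_interior (by rintro _ ⟨v, hv, rfl⟩; exact hS.margin v hv)
  have hK := maxSing_nonneg S.K
  have hl := lamMin_pos hS.P_pos
  -- The radius `q` keeps both `x` and the LQR input, which deviates by at most `maxSing K * q`,
  -- within `δ` of the equilibrium pair.
  set q := δ / (2 * (1 + maxSing S.K)) with hq
  have hq0 : 0 < q := by positivity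
  have hqδ : q * (1 + maxSing S.K) < δ := by
    rw [hq]; field_simp; linarith
  refine ⟨lamMin S.P * q ^ 2, by positivity, fun v hv => ⟨by positivity, fun x hx => ?_⟩⟩
  have hxq : ‖x - S.xEq v‖ ≤ q := norm_le_of_wsq_le hS.P_pos hl hq0.le hx
  have hmem : (x, S.lqr v x) ∈ S.stateSet c.σ ×ˢ S.inputSet c.σ := by
    refine interior_subset (hsub (Metric.mem_thickening_iff.2 ⟨_, ⟨v, hv, rfl⟩, ?_⟩))
    rw [Prod.dist_eq, max_lt_iff, dist_eq_norm, dist_eq_norm]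
    have h2 : ‖mv S.K (x - S.xEq v)‖ ≤ maxSing S.K * q :=
      (norm_mv_le _ _).trans (mul_le_mul_of_nonneg_left hxq hK)
    have h3 : S.lqr v x - S.uEq v = -mv S.K (x - S.xEq v) := by simp [Problem.lqr]
    constructor
    · nlinarith
    · simp only [h3, norm_neg]
      nlinarith
  exact ⟨hmem.2, hmem.1⟩

lemma exists_equilibrium_inputs [NeZero nx] (hS : Standing S c) {v : Vec nv} (hv : v ∈ S.refs) :
    ∃ η, ∀ s ≤ c.σ, S.IsOptimal s (S.xEq v) v η ∧ S.cost (S.xEq v) v η = 0 := by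
  obtain ⟨p, hp0, hp⟩ := exists_terminalLevel hS
  obtain ⟨η, hη, hc⟩ := Problem.exists_feasible_of_mem_ellipsoid hS (hp v hv) (x := S.xEq v)
    (by simp [Problem.ellipsoid, wsq_zero, hp0.le])
  rw [sub_self, wsq_zero] at hc
  refine ⟨η, fun s hs => ⟨⟨hη.anti hs, fun η' _ => ?_⟩, hc⟩⟩
  rw [hc]
  exact Problem.cost_nonneg hS _ _ _

/-- At the equilibrium the same sequence is optimal for the tightenings `σ` and `0`, so the
Lipschitz bound reads `0 ≤ φ σ`. -/
lemma φ_nonneg [NeZero nx] (hS : Standing S c) {v : Vec nv} (hv : v ∈ S.refs) : 0 ≤ c.φ := by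
  obtain ⟨η, hη⟩ := exists_equilibrium_inputs hS hv
  have h := hS.lipschitz_input c.σ 0 hS.σ_pos.le le_rfl _ v hv η η (hη _ le_rfl).1
    (hη _ hS.σ_pos.le).1
  rw [sub_self, norm_zero, sub_zero, abs_of_pos hS.σ_pos] at h
  exact nonneg_of_mul_nonneg_left h hS.σ_pos

lemma zeta1_pos [NeZero nx] (hS : Standing S c) {v : Vec nv} (hv : v ∈ S.refs) :
    0 < zeta1 S c := by
  have h := φ_nonneg hS hv
  have hβ := hS.one_lt_β
  have hm : 0 < max √(maxSing S.B) (maxSing S.B) := lt_max_of_lt_right (maxSing_B_pos hS)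
  unfold zeta1
  positivity

lemma le_zeta1 [NeZero nx] (hS : Standing S c) {v : Vec nv} (hv : v ∈ S.refs) :
    c.β * (maxSing S.B * (c.φ + 1)) ≤ zeta1 S c := by
  have h := φ_nonneg hS hv
  have hβ := hS.one_lt_β
  have := mul_le_mul_of_nonneg_right (le_max_right √(maxSing S.B) (maxSing S.B))
    (show 0 ≤ c.β * (c.φ + 1) by positivity)
  unfold zeta1
  linarith

lemma lamMinH_pos [NeZero nx] [NeZero nu] (hS : Standing S c) : 0 < lamMinH S :=
  lt_min (lamMin_pos hS.Q_pos) (lt_min (lamMin_pos hS.P_pos) (lamMin_pos hS.R_pos))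

lemma zeta2_pos [NeZero nx] [NeZero nu] (hS : Standing S c) : 0 < zeta2 S c := by
  have h := maxSing_B_pos hS
  have h1 := maxSing_nonneg (S.A - 1)
  have h2 := lamMinH_pos hS
  have h3 := hS.π₂_pos
  unfold zeta2
  positivity

lemma alpha1_sq [NeZero nx] (hS : Standing S c) :
    0 < alpha1 S c ∧ (1 - alpha1 S c) ^ 2 = 1 - lamMin S.Q / c.β ^ 2 := by
  have h := hS.α₁_lt
  have hβ := hS.one_lt_β
  have hl := lamMin_pos hS.Q_pos
  unfold alpha1 at h ⊢
  -- The assumption `α₁ < 1` excludes a nonpositive radicand, for which the real square root would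
  -- be `0`.
  have hpos : 0 < 1 - lamMin S.Q / c.β ^ 2 := Real.sqrt_pos.1 (by linarith)
  have hlt : √(1 - lamMin S.Q / c.β ^ 2) < 1 := by
    rw [Real.sqrt_lt' one_pos]
    have : 0 < lamMin S.Q / c.β ^ 2 := by positivity
    linarith
  refine ⟨by linarith, ?_⟩
  rw [sub_sub_cancel, Real.sq_sqrt hpos.le]

lemma one_le_d [NeZero nx] (hS : Standing S c) : 1 ≤ S.d := by
  have h1 := lamMin_pos hS.Q_pos
  have h2 := lamMax_pos hS.P_pos
  rw [Problem.d, le_add_iff_nonneg_left]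
  positivity

lemma psi_xEq [NeZero nx] (hS : Standing S c) {v : Vec nv} (hv : v ∈ S.refs) :
    S.xEq v ∈ S.feasSet 0 ∧ S.psi 0 (S.xEq v) v = 0 := by
  obtain ⟨η, hη⟩ := exists_equilibrium_inputs hS hv
  obtain ⟨h1, h2⟩ := hη 0 hS.σ_pos.le
  refine ⟨⟨η, h1.1⟩, ?_⟩
  rw [Problem.psi, h1.value_eq, h2, Real.sqrt_zero]

lemma psi_le_mul_norm [NeZero nx] (hS : Standing S c) {x : Vec nx} (hx : x ∈ S.feasSet 0)
    {v : Vec nv} (hv : v ∈ S.refs) : S.psi 0 x v ≤ c.β * ‖x - S.xEq v‖ := by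
  obtain ⟨h1, h2⟩ := psi_xEq hS hv
  have h := hS.lipschitz_psi 0 le_rfl x hx _ h1 v hv v hv
  rw [h2, sub_zero, thetaDist_same_ref] at h
  exact (le_abs_self _).trans h

/-- A small cost of an input sequence bounds the deviations of the state and of the first input
from the equilibrium. -/
lemma norm_le_of_cost_le [NeZero nx] [NeZero nu] (hS : Standing S c) {v : Vec nv} {x : Vec nx}
    {η : S.Inputs} {q : ℝ} (hq : 0 ≤ q) (hc : S.cost x v η ≤ q ^ 2) :
    ‖x - S.xEq v‖ ≤ q / √(lamMinH S) ∧ ‖S.firstInput η - S.uEq v‖ ≤ q / √(lamMinH S) := by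
  have hl := lamMinH_pos hS
  have hcost := (Problem.stage_zero_le_cost hS x v η).trans hc
  have hq0 : 0 ≤ q / √(lamMinH S) := by positivity
  have hqsq : lamMinH S * (q / √(lamMinH S)) ^ 2 = q ^ 2 := by
    rw [div_pow, Real.sq_sqrt hl.le]; field_simp
  constructor
  · refine norm_le_of_wsq_le hS.Q_pos (lamMin_pos hS.Q_pos) hq0 ?_
    have h1 : lamMinH S * (q / √(lamMinH S)) ^ 2 ≤ lamMin S.Q * (q / √(lamMinH S)) ^ 2 :=
      mul_le_mul_of_nonneg_right (min_le_left _ _) (sq_nonneg _)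
    linarith [wsq_nonneg hS.R_pos (S.firstInput η - S.uEq v)]
  · refine norm_le_of_wsq_le hS.R_pos (lamMin_pos hS.R_pos) hq0 ?_
    have h1 : lamMinH S * (q / √(lamMinH S)) ^ 2 ≤ lamMin S.R * (q / √(lamMinH S)) ^ 2 :=
      mul_le_mul_of_nonneg_right ((min_le_right _ _).trans (min_le_right _ _)) (sq_nonneg _)
    linarith [wsq_nonneg hS.Q_pos (x - S.xEq v)]

/-! ### Robust feasibility and contraction of the exact closed loop -/

lemma traj_sub_traj (x y : Vec nx) (u : ℕ → Vec nu) (k : ℕ) :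
    S.traj y u k - S.traj x u k = mv (S.A ^ k) (y - x) := by
  induction k with
  | zero => simp [Problem.traj, one_mv]
  | succ k ih =>
    rw [pow_succ', mul_mv, ← ih, mv_sub]
    simp [Problem.traj]

/-- A positive tightening leaves room for a perturbation of the initial state of uniform size. -/
lemma exists_radius_feasible {s : ℝ} (hs : 0 < s) :
    ∃ r, 0 < r ∧ ∀ x ∈ S.feasSet s, ∀ y, ‖y - x‖ < r → y ∈ S.feasSet 0 := by
  have hev : ∀ᶠ δ in 𝓝 (0 : Vec nx), ∀ k : Fin S.N, ∀ j,
      |mv S.C (mv (S.A ^ (k.val + 1)) δ) j| < s := by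
    refine eventually_all.2 fun k => eventually_all.2 fun j => ?_
    have hcont : Continuous fun δ : Vec nx => |mv S.C (mv (S.A ^ (k.val + 1)) δ) j| :=
      ((EuclideanSpace.proj j).continuous.comp
        ((continuous_mv S.C).comp (continuous_mv (S.A ^ (k.val + 1))))).abs
    refine hcont.tendsto 0 |>.eventually (gt_mem_nhds ?_)
    simpa [mv_zero] using hs
  obtain ⟨r, hr, hball⟩ := Metric.eventually_nhds_iff.1 hev
  refine ⟨r, hr, fun x ⟨η, hη⟩ y hy => ⟨η, Problem.feasible_iff.2 fun k hk => ?_⟩⟩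
  obtain ⟨h1, h2⟩ := Problem.feasible_iff.1 hη k hk
  refine ⟨Problem.inputSet_anti hs.le h1, fun j => ?_⟩
  have h3 := abs_lt.1 (hball (y := y - x) (by simpa using hy) ⟨k, hk⟩ j)
  rw [← traj_sub_traj x y (S.ext η), mv_sub] at h3
  simp only [PiLp.sub_apply] at h3
  constructor <;> linarith [(h2 j).1, (h2 j).2]

/-- If a sublevel set of `ψ⁰` is feasible with a positive tightening, then it contains every state
that the Lipschitz bound on `ψ⁰` would place in it. -/
lemma mem_feasSet_of_lipschitz (hS : Standing S c) {s b : ℝ} (hs : 0 < s) {v : Vec nv}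
    (hv : v ∈ S.refs) (hroa : S.roa b v ⊆ S.feasSet s) {x y : Vec nx} (hx : x ∈ S.feasSet 0)
    (hb : S.psi 0 x v + c.β * ‖y - x‖ ≤ b) : y ∈ S.feasSet 0 := by
  obtain ⟨r, hr, hball⟩ := exists_radius_feasible (S := S) hs
  obtain ⟨n, hn⟩ := exists_nat_gt (‖y - x‖ / r)
  have hn0 : (0 : ℝ) < n := lt_of_le_of_lt (by positivity) hn
  have hβ := hS.one_lt_β
  -- Continuation along the segment from `x` to `y` with step length below `r`. A point known to be
  -- feasible satisfies `ψ⁰ ≤ b` by the Lipschitz bound, hence is feasible with tightening `s`, and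
  -- the next point is then feasible too.
  have hind : ∀ i : ℕ, i ≤ n → x + ((i : ℝ) / n) • (y - x) ∈ S.feasSet 0 := by
    intro i
    induction i with
    | zero => intro _; simpa using hx
    | succ i ih =>
      intro hi
      have hfeas := ih (by omega)
      refine hball _ (hroa ⟨hfeas, ?_⟩) _ ?_
      · have h := hS.lipschitz_psi 0 le_rfl _ hfeas x hx v hv v hv
        rw [thetaDist_same_ref, add_sub_cancel_left, norm_smul, Real.norm_of_nonneg (by positivity)]
          at h
        have hin : (i : ℝ) / n ≤ 1 := by
          rw [div_le_one hn0]; exact_mod_cast (show i ≤ n by omega)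
        have h2 : c.β * ((i : ℝ) / n * ‖y - x‖) ≤ c.β * ‖y - x‖ :=
          mul_le_mul_of_nonneg_left (mul_le_of_le_one_left (norm_nonneg _) hin) (by linarith)
        linarith [(le_abs_self _).trans h]
      · have h : x + (((i + 1 : ℕ) : ℝ) / n) • (y - x) - (x + ((i : ℝ) / n) • (y - x)) =
            (1 / n : ℝ) • (y - x) := by
          rw [add_sub_add_left_eq_sub, ← sub_smul]
          congr 1
          push_cast
          ring
        rw [h, norm_smul, Real.norm_of_nonneg (by positivity), one_div_mul_eq_div,
          div_lt_iff₀ hn0]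
        rwa [div_lt_iff₀ hr, mul_comm] at hn
  have := hind n le_rfl
  rwa [div_self hn0.ne', one_smul, add_sub_cancel] at this

/-- Contraction of `ψ⁰` along the exact closed loop. -/
lemma psi_exact_le [NeZero nx] (hS : Standing S c) {p : ℝ} {v : Vec nv} (hv : v ∈ S.refs)
    (hp : S.TerminalLevel 0 p v) {x : Vec nx} {η : S.Inputs} (hη : S.IsOptimal 0 x v η)
    (hψ : S.psi 0 x v ≤ √(S.d * p)) :
    mv S.A x + mv S.B (S.firstInput η) ∈ S.feasSet 0 ∧
      S.psi 0 (mv S.A x + mv S.B (S.firstInput η)) v ≤ (1 - alpha1 S c) * S.psi 0 x v := by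
  have hdp : 0 ≤ S.d * p := mul_nonneg (zero_le_one.trans (one_le_d hS)) hp.1.le
  have hcost : S.cost x v η ≤ S.d * p := by
    rw [← hη.psi_sq hS, ← Real.sq_sqrt hdp]
    exact pow_le_pow_left₀ (Problem.psi_nonneg _ _ _) hψ 2
  obtain ⟨η', hf, hc⟩ := Problem.descent hS hp hη hcost
  refine ⟨⟨η', hf⟩, ?_⟩
  have hβ := hS.one_lt_β
  obtain ⟨-, hα⟩ := alpha1_sq hS
  have h1 := (Problem.psi_sq_le hS v hf).trans hc
  rw [← hη.psi_sq hS] at h1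
  have h2 := lamMin_mul_le_wsq hS.Q_pos.isHermitian (x - S.xEq v)
  have h3 := pow_le_pow_left₀ (Problem.psi_nonneg _ _ _) (psi_le_mul_norm hS ⟨η, hη.1⟩ hv) 2
  rw [mul_pow] at h3
  have h4 : lamMin S.Q / c.β ^ 2 * S.psi 0 x v ^ 2 ≤ lamMin S.Q * ‖x - S.xEq v‖ ^ 2 := by
    rw [div_mul_eq_mul_div, div_le_iff₀ (by positivity), mul_assoc, mul_comm (‖_‖ ^ 2)]
    exact mul_le_mul_of_nonneg_left h3 (lamMin_pos hS.Q_pos).le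
  refine (pow_le_pow_iff_left₀ (Problem.psi_nonneg _ _ _) ?_ two_ne_zero).1 ?_
  · exact mul_nonneg (by linarith [hS.α₁_lt]) (Problem.psi_nonneg _ _ _)
  · rw [mul_pow, hα]
    linarith

/-! ### One-step inequalities of the inexact closed loop -/

variable {W : Type*} {O : Optimizer S W}

/-- The error of the first input computed by the optimizer. -/
lemma norm_firstInput_sub_le (hS : Standing S c) (hO : O.Valid) {s : ℝ} (hs : 0 < s)
    {x : Vec nx} (hx : x ∈ S.feasSet s) {v : Vec nv} (hv : v ∈ S.refs) {w : W} {j : ℕ}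
    (hj : O.StopsAt s x v w j) {η : S.Inputs} (hη : S.IsOptimal 0 x v η) :
    ‖S.firstInput (O.inputs (O.iter s x v w j)) - S.firstInput η‖ ≤ (c.φ + 1) * s := by
  obtain ⟨η', hη'⟩ := Problem.exists_isOptimal hS hs.le v hx
  have h1 := (hO.gap_bound s hs x hx v hv w j hj η' hη').trans hj.1.1
  have h2 := (pow_le_pow_iff_left₀ (norm_nonneg _) hs.le two_ne_zero).1 h1
  have h3 := hS.lipschitz_input s 0 hs.le le_rfl x v hv η' η hη' hη
  rw [sub_zero, abs_of_pos hs] at h3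
  linarith [norm_sub_le_norm_sub_add_norm_sub (S.firstInput (O.inputs (O.iter s x v w j)))
    (S.firstInput η') (S.firstInput η)]

variable {z z' : LoopState nx nv W} {w : W}

lemma InitialOK.mem_feasSet (hz : InitialOK (S := S) c z) : z.x ∈ S.feasSet z.s :=
  Problem.feasSet_anti hz.2.2.2.2.2 (hz.2.1.2.2.2 hz.2.2.2.1).1

lemma InitialOK.exists_optimal (hS : Standing S c) (hO : O.Valid)
    (hz : InitialOK (S := S) c z) (hw : Solves O w z) :
    ∃ η, S.IsOptimal 0 z.x z.v η ∧
      ‖S.firstInput (O.inputs z.w) - S.firstInput η‖ ≤ (c.φ + 1) * z.s := by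
  obtain ⟨η, hη⟩ := Problem.exists_isOptimal hS le_rfl z.v hz.2.2.2.1.1
  obtain ⟨j, hj, hzw⟩ := hw
  refine ⟨η, hη, ?_⟩
  rw [hzw]
  exact norm_firstInput_sub_le hS hO hz.2.2.2.2.1 hz.mem_feasSet hz.1 hj hη

/-- The state equation of the small-gain interconnection. -/
lemma nextState_psi_le [NeZero nx] (hS : Standing S c) (hO : O.Valid)
    (hz : InitialOK (S := S) c z) (hw : Solves O w z) :
    nextState O z ∈ S.feasSet 0 ∧ S.psi 0 (nextState O z) z.v ≤
      (1 - alpha1 S c) * S.psi 0 z.x z.v + zeta1 S c * z.s := by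
  obtain ⟨η, hη, herr⟩ := hz.exists_optimal hS hO hw
  obtain ⟨hv, ⟨hcap, hp, hle, hroa⟩, ⟨hg, -⟩, hx, hs0, hs⟩ := hz
  obtain ⟨hα, -⟩ := alpha1_sq hS
  have hβ := hS.one_lt_β
  obtain ⟨hf, hψ⟩ := psi_exact_le hS hv (hp.anti hcap.le) hη (hx.2.trans hle)
  set y := mv S.A z.x + mv S.B (S.firstInput η)
  have hd : c.β * ‖nextState O z - y‖ ≤ zeta1 S c * z.s := by
    have h : nextState O z - y = mv S.B (S.firstInput (O.inputs z.w) - S.firstInput η) := by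
      simp [nextState, y, mv_sub]
    rw [h]
    have h1 := (norm_mv_le S.B (S.firstInput (O.inputs z.w) - S.firstInput η)).trans
      (mul_le_mul_of_nonneg_left herr (maxSing_nonneg _))
    have h2 := mul_le_mul_of_nonneg_left h1 (show 0 ≤ c.β by linarith)
    have h3 := mul_le_mul_of_nonneg_right (le_zeta1 hS hv) hs0.le
    linarith
  -- The lower gain condition `ζ₁ cap ≤ α₁ bound` absorbs the input error: `(1 - α₁) bound + ζ₁ cap
  -- ≤ bound`.
  have hb : S.psi 0 y z.v + c.β * ‖nextState O z - y‖ ≤ z.bound := by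
    rw [div_mul_eq_mul_div, div_le_iff₀ hα] at hg
    have h1 := mul_le_mul_of_nonneg_left hx.2 (show 0 ≤ 1 - alpha1 S c by linarith [hS.α₁_lt])
    have h2 := mul_le_mul_of_nonneg_left hs (zeta1_pos hS hv).le
    linarith
  have hmem := mem_feasSet_of_lipschitz hS hcap hv (fun _ h => (hroa h).1) hf hb
  refine ⟨hmem, ?_⟩
  have h := hS.lipschitz_psi 0 le_rfl _ hmem y hf z.v hv z.v hv
  rw [thetaDist_same_ref] at h
  linarith [(le_abs_self _).trans h]

/-- The tightening equation of the small-gain interconnection. -/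
lemma tightening_le [NeZero nx] [NeZero nu] (hS : Standing S c) (hO : O.Valid)
    (hz : InitialOK (S := S) c z) (hw : Solves O w z) :
    c.π₁ * z.s + c.π₂ * thetaDist (nextState O z) z.v z.x z.v ≤
      (1 - alpha2 S c) * z.s + zeta2 S c * S.psi 0 z.x z.v := by
  obtain ⟨η, hη, herr⟩ := hz.exists_optimal hS hO hw
  rw [thetaDist_same_ref]
  obtain ⟨hx, hu⟩ := norm_le_of_cost_le hS (Problem.psi_nonneg 0 z.x z.v) (hη.psi_sq hS).ge
  set q := S.psi 0 z.x z.v / √(lamMinH S) with hq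
  -- Subtracting the equilibrium equation splits the displacement into deviations of the state and
  -- of the optimal input, both controlled by `ψ`, and the optimizer error, controlled by `s`.
  have hd : nextState O z - z.x = mv (S.A - 1) (z.x - S.xEq z.v) +
      (mv S.B (S.firstInput η - S.uEq z.v) +
        mv S.B (S.firstInput (O.inputs z.w) - S.firstInput η)) := by
    have h := Problem.equilibrium hS z.v
    rw [← mv_add, sub_mv, one_mv, mv_sub, sub_add_sub_cancel', mv_sub, nextState]
    nth_rw 2 [← h]
    abel
  have h1 : ‖nextState O z - z.x‖ ≤
      maxSing (S.A - 1) * q + (maxSing S.B * q + maxSing S.B * ((c.φ + 1) * z.s)) := by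
    rw [hd]
    refine (norm_add_le _ _).trans (add_le_add ?_ ((norm_add_le _ _).trans (add_le_add ?_ ?_)))
    · exact (norm_mv_le _ _).trans (mul_le_mul_of_nonneg_left hx (maxSing_nonneg _))
    · exact (norm_mv_le _ _).trans (mul_le_mul_of_nonneg_left hu (maxSing_nonneg _))
    · exact (norm_mv_le _ _).trans (mul_le_mul_of_nonneg_left herr (maxSing_nonneg _))
  have h2 := mul_le_mul_of_nonneg_left h1 hS.π₂_pos.le
  have h3 : zeta2 S c * S.psi 0 z.x z.v =
      c.π₂ * (maxSing (S.A - 1) * q + maxSing S.B * q) := by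
    rw [zeta2, hq]; ring
  rw [h3, alpha2]
  linarith

end CompGov

/-! ### Invariance and decay while the reference is held -/

namespace CompGov

variable {nx nu nv mx mu : ℕ} {S : Problem nx nu nv mx mu} {c : Constants}
variable {W : Type*} {O : Optimizer S W} {z z' : LoopState nx nv W} {w : W}

lemma nextState_mem_roa_of_invariance [NeZero nx] (hS : Standing S c) (hO : O.Valid)
    (hz : InitialOK (S := S) c z) (hw : Solves O w z) {v' : Vec nv} (hv' : v' ∈ S.refs)
    {s p b : ℝ} (h : InvarianceConditions S c z.x z.v z.s v' s p b) :
    nextState O z ∈ S.roa b v' := by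
  obtain ⟨hf, hψ⟩ := nextState_psi_le hS hO hz hw
  refine ⟨hf, ?_⟩
  have h1 := hS.lipschitz_psi 0 le_rfl _ hf _ hf v' hv' z.v hz.1
  rw [thetaDist_same_state] at h1
  have h2 := mul_nonneg (alpha1_sq hS).1.le (Problem.psi_nonneg (S := S) 0 z.x z.v)
  linarith [h.1.1, (le_abs_self _).trans h1]

/-- The two halves of the gain condition preserve the two bounds: the lower one `ψ⁰ ≤ bound`, the
upper one `s ≤ cap`. -/
lemma InitialOK.hold [NeZero nx] [NeZero nu] (hS : Standing S c) (hO : O.Valid)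
    (hz : InitialOK (S := S) c z) (hw : Solves O w z) (hv : z'.v = z.v)
    (hx : z'.x = nextState O z)
    (hs : z'.s = c.π₁ * z.s + c.π₂ * thetaDist z'.x z'.v z.x z.v)
    (hcap : z'.cap = z.cap) (hp : z'.p = z.p) (hb : z'.bound = z.bound) :
    InitialOK (S := S) c z' := by
  obtain ⟨hf, hψ⟩ := nextState_psi_le hS hO hz hw
  have ht := tightening_le hS hO hz hw
  rw [hx, hv] at hs
  rw [← hs] at ht
  obtain ⟨hvr, ha, hg, hx0, hs0, hsc⟩ := hz
  have hα1 := (alpha1_sq hS).1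
  refine ⟨hv ▸ hvr, by rwa [hv, hcap, hp, hb], by rwa [hcap, hb], ⟨hx ▸ hf, ?_⟩, ?_, ?_⟩
  · have hg1 := hg.1
    rw [div_mul_eq_mul_div, div_le_iff₀ hα1] at hg1
    have h1 := mul_le_mul_of_nonneg_left hx0.2 (show 0 ≤ 1 - alpha1 S c by linarith [hS.α₁_lt])
    have h2 := mul_le_mul_of_nonneg_left hsc (zeta1_pos hS hvr).le
    rw [hx, hv, hb]
    linarith
  · rw [hs]
    exact add_pos_of_pos_of_nonneg (mul_pos hS.π₁_pos hs0)
      (mul_nonneg hS.π₂_pos.le (Real.sqrt_nonneg _))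
  · have hg2 := hg.2
    rw [div_mul_eq_mul_div, le_div_iff₀ (zeta2_pos hS)] at hg2
    have h1 := mul_le_mul_of_nonneg_left hsc (show 0 ≤ 1 - alpha2 S c by linarith [hS.α₂_lt])
    have h2 := mul_le_mul_of_nonneg_left hx0.2 (zeta2_pos hS).le
    rw [hcap]
    linarith

lemma InitialOK.step [NeZero nx] [NeZero nu] (hS : Standing S c) (hO : O.Valid) {r : Vec nv}
    (hr : r ∈ S.refs) (hz : InitialOK (S := S) c z) (hw : Solves O w z)
    (h : Step c O r z z') : InitialOK (S := S) c z' := by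
  obtain ⟨h0, h1, hv, hx, hzero, hpos, -⟩ := h
  rcases h0.eq_or_lt with hκ | hκ
  · obtain ⟨hs, hcap, hp, hb⟩ := hzero hκ.symm
    exact hz.hold hS hO hw (by rw [hv, ← hκ]; simp) hx hs hcap hp hb
  · obtain ⟨hs, ha, hinv⟩ := hpos hκ
    have hv' : z'.v ∈ S.refs := by
      rw [hv, add_comm]
      exact hS.refs_convex.add_smul_sub_mem hz.1 hr ⟨h0, h1⟩
    refine ⟨hv', ha, hinv.2, hx ▸ nextState_mem_roa_of_invariance hS hO hz hw hv' hinv, ?_, hs.le⟩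
    rw [hs]
    exact ha.1

lemma IsRun.initialOK [NeZero nx] [NeZero nu] (hS : Standing S c) (hO : O.Valid) {r : Vec nv}
    (hr : r ∈ S.refs) {n : ℕ} {z : ℕ → LoopState nx nv W} (h : IsRun c O r w n z) {t : ℕ}
    (ht : t ≤ n) : InitialOK (S := S) c (z t) ∧ ∃ w', Solves O w' (z t) := by
  induction t with
  | zero => exact ⟨h.1, w, h.2.1⟩
  | succ t ih =>
    obtain ⟨h1, w', hw'⟩ := ih (by omega)
    have hstep := h.2.2 t (by omega)
    exact ⟨h1.step hS hO hr hw' hstep, (z t).w, hstep.2.2.2.2.2.2⟩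

/-- On feasible problems the optimizer terminates. -/
lemma exists_stopsAt (hS : Standing S c) (hO : O.Valid) {s : ℝ} (hs : 0 < s) {x : Vec nx}
    (hx : x ∈ S.feasSet s) {v : Vec nv} (hv : v ∈ S.refs) (w : W) :
    ∃ j, O.StopsAt s x v w j := by
  obtain ⟨η, hη⟩ := Problem.exists_isOptimal hS hs.le v hx
  obtain ⟨-, hres, hgap⟩ := hO.convergent s hs x hx v hv w η hη
  have h1 := hgap.eventually (gt_mem_nhds (show 0 < s ^ 2 by positivity))
  have h2 := (hres.pow 2).eventually
    (gt_mem_nhds (show (0 : ℝ) ^ 2 < s ^ 2 by rw [zero_pow two_ne_zero]; positivity))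
  obtain ⟨j, hj1, hj2⟩ := (h1.and h2).exists
  classical
  have hex : ∃ j, O.gap (O.hist s x v w j) ≤ s ^ 2 ∧
      O.residual s x v (O.hist s x v w j) ^ 2 ≤ s ^ 2 := ⟨j, hj1.le, hj2.le⟩
  exact ⟨Nat.find hex, Nat.find_spec hex, fun _ hk => Nat.find_min' hex hk⟩

lemma exists_holdsReference [NeZero nx] [NeZero nu] (hS : Standing S c) (hO : O.Valid)
    {r : Vec nv} (hr : r ∈ S.refs) {i : ℕ} {z : ℕ → LoopState nx nv W} (h : IsRun c O r w i z)
    (k : ℕ) : ∃ z', HoldsReference c O r w z z' i (i + k) := by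
  induction k with
  | zero => exact ⟨z, h, fun _ _ => rfl, fun t h1 h2 => absurd h1 (by omega)⟩
  | succ k ih =>
    obtain ⟨z', hrun, heq, hκ⟩ := ih
    obtain ⟨hok, w', hw'⟩ := hrun.initialOK hS hO hr le_rfl
    set y := z' (i + k) with hy
    let y₀ : LoopState nx nv W :=
      { x := nextState O y, κ := 0, v := y.v,
        s := c.π₁ * y.s + c.π₂ * thetaDist (nextState O y) y.v y.x y.v,
        cap := y.cap, p := y.p, bound := y.bound, w := y.w }
    have hok' : InitialOK (S := S) c y₀ := hok.hold hS hO hw' rfl rfl rfl rfl rfl rfl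
    obtain ⟨j, hj⟩ := exists_stopsAt hS hO hok'.2.2.2.2.1 hok'.mem_feasSet hok'.1 y.w
    let y₁ : LoopState nx nv W := { y₀ with w := O.iter y₀.s y₀.x y₀.v y.w j }
    have hstep : Step c O r y y₁ :=
      ⟨le_rfl, zero_le_one, by simp [y₁, y₀], rfl, fun _ => ⟨rfl, rfl, rfl, rfl⟩,
        fun hlt => absurd hlt (lt_irrefl _), j, hj, rfl⟩
    have hle {t : ℕ} (ht : t ≤ i + k) : (if t ≤ i + k then z' t else y₁) = z' t := if_pos ht
    have hgt {t : ℕ} (ht : i + k < t) : (if t ≤ i + k then z' t else y₁) = y₁ :=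
      if_neg (by omega)
    refine ⟨fun t => if t ≤ i + k then z' t else y₁, ⟨?_, ?_, fun t ht => ?_⟩, fun t ht => ?_,
      fun t h1 h2 => ?_⟩
    · simpa using hrun.1
    · simpa using hrun.2.1
    · rcases (show t < i + k ∨ t = i + k by omega) with h1 | h1
      · simp only [hle h1.le, hle h1]
        exact hrun.2.2 t h1
      · simp only [hle h1.le, hgt (show i + k < t + 1 by omega)]
        rwa [h1, ← hy]
    · simp only [hle (show t ≤ i + k by omega)]
      exact heq t ht
    · rcases le_or_gt t (i + k) with h3 | h3
      · simp only [hle h3]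
        exact hκ t h1 h3
      · simp only [hgt h3]
        rfl

/-- A linear Lyapunov function for the small-gain interconnection of state and tightening. -/
lemma exists_contraction [NeZero nx] [NeZero nu] (hS : Standing S c) {v : Vec nv}
    (hv : v ∈ S.refs) : ∃ a ρ : ℝ, zeta1 S c ≤ a ∧ 0 ≤ ρ ∧ ρ < 1 ∧ ∀ ψ s ψ' s' : ℝ, 0 ≤ ψ → 0 ≤ s →
      ψ' ≤ (1 - alpha1 S c) * ψ + zeta1 S c * s → s' ≤ (1 - alpha2 S c) * s + zeta2 S c * ψ →
        ψ' + a * s' ≤ ρ * (ψ + a * s) := by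
  have hζ1 := zeta1_pos hS hv
  have hζ2 := zeta2_pos hS
  have hα2 := hS.α₂_pos
  have hα2' := hS.α₂_lt
  have hα1 := hS.α₁_lt
  have hsg := hS.small_gain
  rw [div_lt_div_iff₀ hα2 hζ1] at hsg
  -- Cross-multiplying the small-gain condition opens this interval for `a`: its lower end makes the
  -- coefficient of `s` contract, its upper end that of `ψ`. Since `α₂ < 1`, also `ζ₁ ≤ a`, so `ψ +
  -- a s` dominates the quantity `ψ + ζ₁ s` of the invariance condition.
  obtain ⟨a, ha1, ha2⟩ := exists_between (show zeta1 S c / alpha2 S c < alpha1 S c / zeta2 S c by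
    rw [div_lt_div_iff₀ hα2 hζ2]; linarith)
  rw [div_lt_iff₀ hα2] at ha1
  rw [lt_div_iff₀ hζ2] at ha2
  have ha : zeta1 S c ≤ a := by nlinarith
  have ha0 : 0 < a := hζ1.trans_le ha
  refine ⟨a, max (1 - alpha1 S c + a * zeta2 S c) (1 - alpha2 S c + zeta1 S c / a), ha,
    le_max_of_le_left ?_, max_lt (by linarith) ?_, fun ψ s ψ' s' hψ hs h1 h2 => ?_⟩
  · have := mul_pos ha0 hζ2
    linarith
  · have : zeta1 S c / a < alpha2 S c := by rw [div_lt_iff₀ ha0]; linarith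
    linarith
  · have h3 := mul_le_mul_of_nonneg_right
      (le_max_left (1 - alpha1 S c + a * zeta2 S c) (1 - alpha2 S c + zeta1 S c / a)) hψ
    have h4 := mul_le_mul_of_nonneg_right
      (le_max_right (1 - alpha1 S c + a * zeta2 S c) (1 - alpha2 S c + zeta1 S c / a))
      (mul_nonneg ha0.le hs)
    have h5 := mul_le_mul_of_nonneg_left h2 ha0.le
    have h6 : zeta1 S c / a * (a * s) = zeta1 S c * s := by field_simp
    linarith

lemma HoldsReference.decay [NeZero nx] [NeZero nu] (hS : Standing S c) (hO : O.Valid)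
    {r : Vec nv} (hr : r ∈ S.refs) {a ρ : ℝ} (hρ : 0 ≤ ρ)
    (hcon : ∀ ψ s ψ' s' : ℝ, 0 ≤ ψ → 0 ≤ s →
      ψ' ≤ (1 - alpha1 S c) * ψ + zeta1 S c * s → s' ≤ (1 - alpha2 S c) * s + zeta2 S c * ψ →
        ψ' + a * s' ≤ ρ * (ψ + a * s))
    {i n : ℕ} {z z' : ℕ → LoopState nx nv W} (h : HoldsReference c O r w z z' i (i + n))
    {k : ℕ} (hk : k ≤ n) :
    (z' (i + k)).v = (z i).v ∧ S.psi 0 (z' (i + k)).x (z' (i + k)).v + a * (z' (i + k)).s ≤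
      ρ ^ k * (S.psi 0 (z i).x (z i).v + a * (z i).s) := by
  induction k with
  | zero =>
    rw [add_zero, h.2.1 i le_rfl, pow_zero, one_mul]
    exact ⟨rfl, le_rfl⟩
  | succ k ih =>
    obtain ⟨hv, hdec⟩ := ih (by omega)
    obtain ⟨hok, w', hw'⟩ := h.1.initialOK hS hO hr (show i + k ≤ i + n by omega)
    obtain ⟨-, -, hv', hx, hzero, -, -⟩ := h.1.2.2 (i + k) (by omega)
    have hκ := h.2.2 (i + k + 1) (by omega) (by omega)
    obtain ⟨hs, -⟩ := hzero hκ
    rw [hκ, zero_smul, zero_add] at hv'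
    have hψ := (nextState_psi_le hS hO hok hw').2
    have ht := tightening_le hS hO hok hw'
    rw [← hx, ← hv'] at hψ
    rw [hv'] at hs hψ
    rw [← hx, ← hs] at ht
    refine ⟨hv'.trans hv, ?_⟩
    rw [pow_succ', mul_assoc, ← add_assoc, hv']
    exact (hcon _ _ _ _ (Problem.psi_nonneg _ _ _) hok.2.2.2.2.1.le hψ ht).trans
      (mul_le_mul_of_nonneg_left hdec hρ)

/-! ### Reference steps near an equilibrium -/

lemma mem_ellipsoid_of_norm_le [NeZero nx] (hS : Standing S c) {v : Vec nv} {x : Vec nx}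
    {q p : ℝ} (hx : ‖x - S.xEq v‖ ≤ q) (hq : lamMax S.P * q ^ 2 ≤ p) : x ∈ S.ellipsoid p v :=
  ((wsq_le_lamMax_mul hS.P_pos.isHermitian _).trans (mul_le_mul_of_nonneg_left
    (pow_le_pow_left₀ (norm_nonneg _) hx 2) (lamMax_pos hS.P_pos).le)).trans hq

lemma mem_feasSet_of_cost_le [NeZero nx] [NeZero nu] (hS : Standing S c) {p : ℝ} {v : Vec nv}
    (hp : S.TerminalLevel c.σ p v) {x : Vec nx} {η : S.Inputs} {q : ℝ} (hq : 0 ≤ q)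
    (hq1 : lamMax S.P * (q / √(lamMinH S)) ^ 2 ≤ p)
    (hq2 : lamMax S.P * ((maxSing S.A + maxSing S.B) * (q / √(lamMinH S))) ^ 2 ≤ p)
    (hc : S.cost x v η ≤ q ^ 2) :
    x ∈ S.feasSet c.σ ∧ mv S.A x + mv S.B (S.firstInput η) ∈ S.feasSet c.σ := by
  obtain ⟨hx, hu⟩ := norm_le_of_cost_le hS hq hc
  have hfeas {y : Vec nx} (hy : y ∈ S.ellipsoid p v) : y ∈ S.feasSet c.σ := by
    obtain ⟨η', hη', -⟩ := Problem.exists_feasible_of_mem_ellipsoid hS hp hy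
    exact ⟨η', hη'⟩
  refine ⟨hfeas (mem_ellipsoid_of_norm_le hS hx hq1), hfeas (mem_ellipsoid_of_norm_le hS ?_ hq2)⟩
  rw [Problem.next_sub_xEq hS, add_mul]
  exact (norm_add_le _ _).trans (add_le_add
    ((norm_mv_le _ _).trans (mul_le_mul_of_nonneg_left hx (maxSing_nonneg _)))
    ((norm_mv_le _ _).trans (mul_le_mul_of_nonneg_left hu (maxSing_nonneg _))))

/-- Small bounds on `ψ⁰` define region of attraction estimates. -/
lemma admissibleROA_of_small [NeZero nx] [NeZero nu] (hS : Standing S c) {p : ℝ} {v : Vec nv}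
    (hp : S.TerminalLevel c.σ p v) {s b : ℝ} (hs : 0 < s) (hsσ : s ≤ c.σ) (hb : 0 ≤ b)
    (hbp : b ^ 2 ≤ p) (hq : lamMax S.P * (b / √(lamMinH S)) ^ 2 ≤ p) :
    S.AdmissibleROA v s p b := by
  have hpd : p ≤ S.d * p := le_mul_of_one_le_left hp.1.le (one_le_d hS)
  refine ⟨hs, hp.anti hsσ, Real.le_sqrt_of_sq_le (hbp.trans hpd), fun x hx => ?_⟩
  obtain ⟨η, hη⟩ := Problem.exists_isOptimal hS le_rfl v hx.1
  have hcost : S.cost x v η ≤ b ^ 2 := by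
    rw [← hη.psi_sq hS]
    exact pow_le_pow_left₀ (Problem.psi_nonneg _ _ _) hx.2 2
  -- A small `ψ⁰` forces the state into the terminal ellipsoid, where LQR is feasible with
  -- tightening `s` at cost at most `p ≤ d p`.
  have hmem := mem_ellipsoid_of_norm_le hS (norm_le_of_cost_le hS hb hcost).1 hq
  obtain ⟨η', hη', hc'⟩ := Problem.exists_feasible_of_mem_ellipsoid hS (hp.anti hsσ) hmem
  refine ⟨⟨η', hη'⟩, Real.le_sqrt_of_sq_le ?_⟩
  exact ((Problem.psi_sq_le hS v hη').trans (hc'.le.trans hmem)).trans hpd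

/-- Once `ψ⁰` and the tightening are small, the reference can move by `ε`. -/
lemma stepOfSizePossible_of_small [NeZero nx] [NeZero nu] (hS : Standing S c) (hO : O.Valid)
    {p : ℝ} (hp : ∀ v ∈ S.refs, S.TerminalLevel c.σ p v) {ε : ℝ} (hε : 0 < ε)
    (hbp : (2 * c.β * ε) ^ 2 ≤ p)
    (hq : lamMax S.P * (2 * c.β * ε / √(lamMinH S)) ^ 2 ≤ p)
    (hs : alpha1 S c / zeta1 S c * (2 * c.β * ε) < c.σ) {r : Vec nv} (hr : r ∈ S.refs)
    (hz : InitialOK (S := S) c z) (hw : Solves O w z) (hfar : ε < ‖z.v - r‖)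
    (hsmall : S.psi 0 z.x z.v + zeta1 S c * z.s ≤ c.β * ε) :
    StepOfSizePossible c O r ε z := by
  have hβ := hS.one_lt_β
  have hζ1 := zeta1_pos hS hr
  have hζ2 := zeta2_pos hS
  have hα1 := (alpha1_sq hS).1
  have hα2 := hS.α₂_pos
  have hb : 0 < 2 * c.β * ε := by positivity
  rw [norm_sub_rev] at hfar
  have hfar0 := hε.trans hfar
  have hκ : 0 < ε / ‖r - z.v‖ := div_pos hε hfar0
  have hκ1 : ε / ‖r - z.v‖ ≤ 1 := (div_le_one hfar0).2 hfar.le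
  have hv : (ε / ‖r - z.v‖) • (r - z.v) + z.v ∈ S.refs := by
    rw [add_comm]
    exact hS.refs_convex.add_smul_sub_mem hz.1 hr ⟨hκ.le, hκ1⟩
  have hnorm : ‖(ε / ‖r - z.v‖) • (r - z.v) + z.v - z.v‖ = ε := by
    rw [add_sub_cancel_right, norm_smul, Real.norm_of_nonneg hκ.le,
      div_mul_cancel₀ _ hfar0.ne']
  set v := (ε / ‖r - z.v‖) • (r - z.v) + z.v with hvdef
  have hadm := admissibleROA_of_small hS (hp v hv) (by positivity) hs.le hb.le hbp hq
  -- The bound `2 β ε` is split equally between the reference change and `ψ⁰ + ζ₁ s`. The new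
  -- tightening makes the lower gain condition an equality; the upper one is then the small-gain
  -- condition.
  have hinv : InvarianceConditions S c z.x z.v z.s v
      (alpha1 S c / zeta1 S c * (2 * c.β * ε)) p (2 * c.β * ε) := by
    refine ⟨⟨?_, hadm.2.2.1⟩, ?_, ?_⟩
    · rw [hnorm]
      linarith
    · rw [← mul_assoc, div_mul_div_cancel₀ hα1.ne', div_self hζ1.ne', one_mul]
    · rw [← mul_assoc]
      refine le_mul_of_one_le_left hb.le ?_
      have hsg := hS.small_gain
      rw [div_lt_div_iff₀ hα2 hζ1] at hsg
      rw [div_mul_div_comm, one_le_div (by positivity)]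
      linarith
  exact ⟨_, v, _, p, _, hκ, hκ1, hvdef, hv, hnorm, hs, hadm, hz.2.2.2.1.1, hinv,
    nextState_mem_roa_of_invariance hS hO hz hw hv hinv⟩

end CompGov

/-! ### Choice of `ε₀` and conclusion -/

theorem theorem1 {nx nu nv mx mu : ℕ} (S : CompGov.Problem nx nu nv mx mu)
    (c : CompGov.Constants) (hS : CompGov.Standing S c) :
    ∃ ε₀ : ℝ, 0 < ε₀ ∧ ∀ ε : ℝ, 0 < ε → ε ≤ ε₀ →
      ∀ (W : Type*) (O : CompGov.Optimizer S W), O.Valid →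
        CompGov.SmallCostFeasible c O ε ∧
        ∀ r ∈ S.refs, ∀ (w : W) (i' : ℕ) (z : ℕ → CompGov.LoopState nx nv W),
          CompGov.IsRun c O r w i' z → ε < ‖(z i').v - r‖ →
            ∃ i, i' < i ∧
              (∃ z', CompGov.HoldsReference c O r w z z' i' (i - 1)) ∧
              ∀ z', CompGov.HoldsReference c O r w z z' i' (i - 1) →
                CompGov.StepOfSizePossible c O r ε (z' (i - 1)) := by
  open CompGov in
  have := neZero_nx hS
  have := neZero_nu hS
  have hβ := hS.one_lt_β
  obtain ⟨p, hp0, hp⟩ := exists_terminalLevel hS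
  have hlim (f : ℝ → ℝ) (hf : Continuous f) (hf0 : f 0 = 0) {y : ℝ} (hy : 0 < y) :
      ∀ᶠ q in 𝓝 (0 : ℝ), f q < y :=
    (hf.tendsto 0).eventually (gt_mem_nhds (by rwa [hf0]))
  obtain ⟨δ, hδ, hsmall⟩ := Metric.eventually_nhds_iff.1
    (((hlim (fun q => q ^ 2) (by fun_prop) (by simp) hp0).and
      (hlim (fun q => lamMax S.P * (q / √(lamMinH S)) ^ 2) (by fun_prop) (by simp) hp0)).and
    ((hlim (fun q => lamMax S.P * ((maxSing S.A + maxSing S.B) * (q / √(lamMinH S))) ^ 2)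
      (by fun_prop) (by simp) hp0).and
      (hlim (fun q => alpha1 S c / zeta1 S c * q) (by fun_prop) (by simp) hS.σ_pos)))
  have hsmall' {q : ℝ} (h0 : 0 ≤ q) (h1 : q < δ) := hsmall (y := q)
    (by rwa [Real.dist_eq, sub_zero, abs_of_nonneg h0])
  -- The smallness conditions are used at `β ε` for the cost and at `2 β ε` for the bound; the
  -- factor `4` gives `2 β ε ≤ δ / 2 < δ`.
  refine ⟨δ / (4 * c.β), by positivity, fun ε hε hε0 W O hO => ?_⟩
  rw [le_div_iff₀ (by positivity)] at hε0
  have hβε : 0 < c.β * ε := by positivity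
  refine ⟨fun z hv _ hcost => ?_, fun r hr w i' z hrun hfar => ?_⟩
  · obtain ⟨⟨-, h1⟩, h2, -⟩ := hsmall' hβε.le (by linarith)
    refine mem_feasSet_of_cost_le hS (hp _ hv) hβε.le h1.le h2.le ?_
    exact (Real.sqrt_le_left hβε.le).1 hcost
  · obtain ⟨⟨h1, h2⟩, -, h3⟩ := hsmall' (q := 2 * c.β * ε) (by positivity) (by linarith)
    obtain ⟨a, ρ, ha, hρ0, hρ1, hcon⟩ := exists_contraction hS hr
    set V := S.psi 0 (z i').x (z i').v + a * (z i').s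
    have hok := (hrun.initialOK hS hO hr le_rfl).1
    have ha0 : 0 < a := (zeta1_pos hS hr).trans_le ha
    have hV : 0 < V :=
      add_pos_of_nonneg_of_pos (Problem.psi_nonneg _ _ _) (mul_pos ha0 hok.2.2.2.2.1)
    obtain ⟨n, hn⟩ := exists_pow_lt_of_lt_one (div_pos hβε hV) hρ1
    rw [lt_div_iff₀ hV] at hn
    -- The reference is held for `n` steps, up to `i - 1 = i' + n`. There `ψ + ζ₁ s ≤ ψ + a s ≤ ρ ^
    -- n * V < β ε`, for every continuation, because `V` depends only on the state at `i'`.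
    refine ⟨i' + n + 1, by omega, exists_holdsReference hS hO hr hrun n, fun z' hz' => ?_⟩
    rw [Nat.add_sub_cancel] at hz' ⊢
    obtain ⟨hok', w', hw'⟩ := hz'.1.initialOK hS hO hr le_rfl
    obtain ⟨hv, hdec⟩ := hz'.decay hS hO hr hρ0 hcon le_rfl
    refine stepOfSizePossible_of_small hS hO hp hε h1.le h2.le h3 hr hok' hw' (hv ▸ hfar) ?_
    have := mul_le_mul_of_nonneg_right ha hok'.2.2.2.2.1.le
    linarith
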